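/- Let $k$ be a field of characteristic $p>0$ and let $k[\boldsymbol x]=k[x_1,x_2,x_3]$ be the polynomial ring in three variables. Fix integers $l,m\ge 1$ and $t\ge 2$ with $mt\ge 3$, and set $$f:=x_1x_3-x_2^t,\qquad r:=f^lx_2+x_1^m,\qquad g:=x_1^{-1}\bigl(f^{lt+1}+r^t\bigr)\in k[\boldsymbol x],\qquad C:=k[f,f^{-1},g,g^{-1}]\subset k(x_1,x_2,x_3).$$ The element $r$ is transcendental over $C$, one has $k[\boldsymbol x]\subset C[r]$, and the map $C[r]\to C[r][T]$, $u(r)\mapsto u(r+f^lg\,T)$ (for polynomials $u$ over $C$) restricts to a ${\bf G}_a$-action $\epsilon:k[\boldsymbol x]\to k[\boldsymbol x][T]$. Let $k[\boldsymbol x]^{\epsilon}=\{u\mid \epsilon(u)=u\}$, let $0\neq h\in k[\boldsymbol x]^{\epsilon}$, let $\epsilon_h:k[\boldsymbol x]\to k[\boldsymbol x]$ be the map $u\mapsto \epsilon(u)|_{T=h}$, and let $k[\boldsymbol x]^{\epsilon_h}=\{u\mid \epsilon_h(u)=u\}$. Put $$q:=r^p-(f^lgh)^{p-1}r,\qquad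 \psi:C[r^p]\to C[q],\quad u(r^p)\mapsto u(q)\ \text{ (for polynomials $u$ over $C$)}.$$ Assume that $p\mid t$, and put $q_1:=g^{-1}\bigl(f^{lt+1}+q^{t/p}\bigr)$. (i) The element $q_1$ lies in $k[\boldsymbol x]^{\epsilon_h}$, and there exist $q_2,q_3\in k[\boldsymbol x]^{\epsilon_h}$ such that $q_1q_3-q_2^{t/p}=f$ and $k[\boldsymbol x]^{\epsilon_h}=k[q_1,q_2,q_3]$. Here $q_1,q_2,q_3$ are algebraically independent over $k$; in particular, $k[\boldsymbol x]^{\epsilon_h}$ is isomorphic as a $k$-algebra to the polynomial ring in three variables over $k$. (ii) One has $k[x_1,x_2^p,x_3]\subset C[r^p]$, and $$\psi\bigl(k[x_1,x_2^p,x_3]\bigr)=k[\boldsymbol x]^{\epsilon_h}\quad\Longleftrightarrow\quad h^{p-1}\in f^l\,k[f,g].$$ -/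

import Mathlib

/-- The fixed exponents: `l, m ≥ 1`, `t ≥ 2` and `m t ≥ 3`. -/
structure Exponents where
  l : ℕ
  m : ℕ
  t : ℕ
  one_le_l : 1 ≤ l
  one_le_m : 1 ≤ m
  two_le_t : 2 ≤ t
  three_le_mt : 3 ≤ m * t

namespace RankThree

noncomputable section

/-- The polynomial ring `k[x₁, x₂, x₃]`; the variables `x₁, x₂, x₃` are `X 0, X 1, X 2`. -/
abbrev Poly (k : Type*) [Field k] : Type _ := MvPolynomial (Fin 3) k

/-- The field of rational functions `k(x₁, x₂, x₃)`. -/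
abbrev RatFun (k : Type*) [Field k] : Type _ := FractionRing (Poly k)

/-- The inclusion of `k[x₁, x₂, x₃]` into `k(x₁, x₂, x₃)`. -/
abbrev incl (k : Type*) [Field k] : Poly k →ₐ[k] RatFun k := IsScalarTower.toAlgHom k (Poly k) (RatFun k)

/-- `f = x₁ x₃ - x₂ ^ t`. -/
def f (k : Type*) [Field k] (E : Exponents) : Poly k :=
  MvPolynomial.X 0 * MvPolynomial.X 2 - MvPolynomial.X 1 ^ E.t

/-- `r = f ^ l x₂ + x₁ ^ m`. -/
def r (k : Type*) [Field k] (E : Exponents) : Poly k :=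
  f k E ^ E.l * MvPolynomial.X 1 + MvPolynomial.X 0 ^ E.m

/-- The polynomial `g = x₁⁻¹ (f ^ (l t + 1) + r ^ t)`, written out by means of the binomial
expansion of `r ^ t`; see `X_zero_mul_g`. -/
def g (k : Type*) [Field k] (E : Exponents) : Poly k :=
  f k E ^ (E.l * E.t) * MvPolynomial.X 2 +
    ∑ i ∈ Finset.range E.t, (f k E ^ E.l * MvPolynomial.X 1) ^ i *
      MvPolynomial.X 0 ^ (E.m * (E.t - i) - 1) * (E.t.choose i : Poly k)

theorem f_eq (k : Type*) [Field k] (E : Exponents) :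
    f k E = MvPolynomial.X 0 * MvPolynomial.X 2 - MvPolynomial.X 1 ^ E.t := rfl

theorem r_eq (k : Type*) [Field k] (E : Exponents) :
    r k E = f k E ^ E.l * MvPolynomial.X 1 + MvPolynomial.X 0 ^ E.m := rfl

theorem g_eq (k : Type*) [Field k] (E : Exponents) :
    g k E = f k E ^ (E.l * E.t) * MvPolynomial.X 2 +
      ∑ i ∈ Finset.range E.t, (f k E ^ E.l * MvPolynomial.X 1) ^ i *
        MvPolynomial.X 0 ^ (E.m * (E.t - i) - 1) * (E.t.choose i : Poly k) := rfl

theorem X_zero_mul_g (k : Type*) [Field k] (E : Exponents) :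
    MvPolynomial.X 0 * g k E = f k E ^ (E.l * E.t + 1) + r k E ^ E.t := by
  have key : ∀ i ∈ Finset.range E.t, MvPolynomial.X 0 * ((f k E ^ E.l * MvPolynomial.X 1) ^ i *
      MvPolynomial.X 0 ^ (E.m * (E.t - i) - 1) * (E.t.choose i : Poly k)) =
      (f k E ^ E.l * MvPolynomial.X 1) ^ i *
        (MvPolynomial.X 0 ^ E.m) ^ (E.t - i) * (E.t.choose i : Poly k) := by
    intro i hi
    have h1 : 1 ≤ E.m * (E.t - i) :=
      Nat.mul_pos E.one_le_m (Nat.sub_pos_of_lt (Finset.mem_range.mp hi))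
    obtain ⟨n, hn⟩ := Nat.exists_eq_add_of_le h1
    rw [← pow_mul, hn, Nat.add_sub_cancel_left]
    ring
  have hr : r k E ^ E.t = ∑ i ∈ Finset.range E.t, (f k E ^ E.l * MvPolynomial.X 1) ^ i *
        (MvPolynomial.X 0 ^ E.m) ^ (E.t - i) * (E.t.choose i : Poly k) +
        (f k E ^ E.l * MvPolynomial.X 1) ^ E.t := by
    rw [r, add_pow, Finset.sum_range_succ]
    simp
  have hf : f k E ^ (E.l * E.t + 1) = f k E ^ (E.l * E.t) *
      (MvPolynomial.X 0 * MvPolynomial.X 2 - MvPolynomial.X 1 ^ E.t) := by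
    rw [pow_succ]; rfl
  rw [g, mul_add, Finset.mul_sum, Finset.sum_congr rfl key, hr, hf, mul_pow _ _ E.t, ← pow_mul]
  ring

theorem f_ne_zero (k : Type*) [Field k] (E : Exponents) : f k E ≠ 0 := by
  intro h
  have := congrArg (MvPolynomial.eval (![1, 0, 1] : Fin 3 → k)) h
  have ht : E.t ≠ 0 := by have := E.two_le_t; omega
  simp [f, ht] at this

theorem g_ne_zero (k : Type*) [Field k] (E : Exponents) : g k E ≠ 0 := by
  intro h
  have h2 := X_zero_mul_g k E
  have h1 := congrArg (MvPolynomial.eval (![1, 0, 0] : Fin 3 → k)) h2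
  have ht : E.t ≠ 0 := by have := E.two_le_t; omega
  rw [h] at h1
  simp [f, r, ht] at h1

/-- The ring `C = k[f, f⁻¹, g, g⁻¹]`, inside `k(x₁, x₂, x₃)`. -/
def ringC (k : Type*) [Field k] (E : Exponents) : Subalgebra k (RatFun k) :=
  Algebra.adjoin k
    {incl k (f k E), (incl k (f k E))⁻¹, incl k (g k E), (incl k (g k E))⁻¹}

theorem f_mem (k : Type*) [Field k] (E : Exponents) : incl k (f k E) ∈ ringC k E :=
  Algebra.subset_adjoin (by simp)

theorem f_inv_mem (k : Type*) [Field k] (E : Exponents) : (incl k (f k E))⁻¹ ∈ ringC k E :=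
  Algebra.subset_adjoin (by simp)

theorem g_mem (k : Type*) [Field k] (E : Exponents) : incl k (g k E) ∈ ringC k E :=
  Algebra.subset_adjoin (by simp)

theorem g_inv_mem (k : Type*) [Field k] (E : Exponents) : (incl k (g k E))⁻¹ ∈ ringC k E :=
  Algebra.subset_adjoin (by simp)

theorem X_zero_eq (k : Type*) [Field k] (E : Exponents) :
    incl k (MvPolynomial.X 0) = (incl k (g k E))⁻¹ *
      (incl k (f k E) ^ (E.l * E.t + 1) + incl k (r k E) ^ E.t) := by
  have hg : incl k (g k E) ≠ 0 := by simpa using g_ne_zero k E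
  have := congrArg (incl k) (X_zero_mul_g k E)
  rw [map_mul, map_add, map_pow, map_pow] at this
  rw [← this]
  field_simp

theorem X_one_eq (k : Type*) [Field k] (E : Exponents) :
    incl k (MvPolynomial.X 1) = (incl k (f k E))⁻¹ ^ E.l *
      (incl k (r k E) - incl k (MvPolynomial.X 0) ^ E.m) := by
  have hf : incl k (f k E) ≠ 0 := by simpa using f_ne_zero k E
  have : incl k (r k E) = incl k (f k E) ^ E.l * incl k (MvPolynomial.X 1) +
      incl k (MvPolynomial.X 0) ^ E.m := by
    rw [← map_pow, ← map_pow, ← map_mul, ← map_add]; rfl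
  rw [this, add_sub_cancel_right, ← mul_assoc, ← mul_pow, inv_mul_cancel₀ hf, one_pow, one_mul]

theorem X_two_eq (k : Type*) [Field k] (E : Exponents) :
    incl k (MvPolynomial.X 2) = (incl k (f k E))⁻¹ ^ (E.l * E.t) *
      (incl k (g k E) - ∑ i ∈ Finset.range E.t,
        (incl k (f k E) ^ E.l * incl k (MvPolynomial.X 1)) ^ i *
        incl k (MvPolynomial.X 0) ^ (E.m * (E.t - i) - 1) * (E.t.choose i : RatFun k)) := by
  have hf : incl k (f k E) ≠ 0 := by simpa using f_ne_zero k E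
  have : incl k (g k E) = incl k (f k E) ^ (E.l * E.t) * incl k (MvPolynomial.X 2) +
      ∑ i ∈ Finset.range E.t,
        (incl k (f k E) ^ E.l * incl k (MvPolynomial.X 1)) ^ i *
        incl k (MvPolynomial.X 0) ^ (E.m * (E.t - i) - 1) * (E.t.choose i : RatFun k) := by
    conv_lhs => rw [g]
    simp only [map_add, map_mul, map_sum, map_pow, map_natCast]
  rw [this, add_sub_cancel_right, ← mul_assoc, ← mul_pow, inv_mul_cancel₀ hf, one_pow, one_mul]

/-- A `k`-subalgebra of `k(x₁, x₂, x₃)` containing `C` and `r` contains `k[x₁, x₂, x₃]`. -/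
theorem incl_mem_of_le {k : Type*} [Field k] (E : Exponents) (S : Subalgebra k (RatFun k))
    (hC : ringC k E ≤ S) (hr : incl k (r k E) ∈ S) (u : Poly k) : incl k u ∈ S := by
  have h0 : incl k (MvPolynomial.X 0) ∈ S := by
    rw [X_zero_eq k E]
    exact S.mul_mem (hC (g_inv_mem k E))
      (S.add_mem (S.pow_mem (hC (f_mem k E)) _) (S.pow_mem hr _))
  have h1 : incl k (MvPolynomial.X 1) ∈ S := by
    rw [X_one_eq k E]
    exact S.mul_mem (S.pow_mem (hC (f_inv_mem k E)) _) (S.sub_mem hr (S.pow_mem h0 _))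
  have h2 : incl k (MvPolynomial.X 2) ∈ S := by
    rw [X_two_eq k E]
    refine S.mul_mem (S.pow_mem (hC (f_inv_mem k E)) _) (S.sub_mem (hC (g_mem k E))
      (S.sum_mem fun i _ => S.mul_mem (S.mul_mem (S.pow_mem (S.mul_mem
        (S.pow_mem (hC (f_mem k E)) _) h1) _) (S.pow_mem h0 _)) (natCast_mem S _)))
  induction u using MvPolynomial.induction_on with
  | C a =>
    have : incl k (MvPolynomial.C a) = algebraMap k (RatFun k) a := (incl k).commutes a
    rw [this]; exact S.algebraMap_mem a
  | add p q hp hq => rw [map_add]; exact S.add_mem hp hq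
  | mul_X p i hp =>
    rw [map_mul]
    refine S.mul_mem hp ?_
    fin_cases i
    · exact h0
    · exact h1
    · exact h2

/-- `r` is transcendental over `C`. -/
theorem transcendental_r (k : Type*) [Field k] (E : Exponents) :
    Transcendental (ringC k E) (incl k (r k E)) := by
  intro halg
  let s : Set (RatFun k) := {incl k (f k E), incl k (g k E)}
  let F := IntermediateField.adjoin k s
  have hfF : incl k (f k E) ∈ F := IntermediateField.subset_adjoin k s (by simp [s])
  have hgF : incl k (g k E) ∈ F := IntermediateField.subset_adjoin k s (by simp [s])
  have hCF : ringC k E ≤ F.toSubalgebra := by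
    refine Algebra.adjoin_le ?_
    rintro x (rfl | rfl | rfl | rfl)
    · exact hfF
    · exact F.inv_mem hfF
    · exact hgF
    · exact F.inv_mem hgF
  have halgF : IsAlgebraic F (incl k (r k E)) := by
    obtain ⟨u, hu, hu0⟩ := halg
    let j : ringC k E →+* F := (Subalgebra.inclusion hCF).toRingHom
    have hj : Function.Injective j := Subalgebra.inclusion_injective hCF
    refine ⟨u.map j, (Polynomial.map_ne_zero_iff hj).mpr hu, ?_⟩
    rw [Polynomial.aeval_def, Polynomial.eval₂_map]
    exact hu0
  let L := algebraicClosure F (RatFun k)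
  have hCL : ringC k E ≤ L.toSubalgebra.restrictScalars k := fun x hx =>
    L.algebraMap_mem (⟨x, hCF hx⟩ : F)
  have hP : ∀ u : Poly k, incl k u ∈ L :=
    incl_mem_of_le E (L.toSubalgebra.restrictScalars k) hCL (mem_algebraicClosure_iff.mpr halgF)
  have hall : Algebra.IsAlgebraic F (RatFun k) := by
    refine ⟨fun x => ?_⟩
    obtain ⟨a, b, -, rfl⟩ := IsFractionRing.div_surjective (A := Poly k) x
    exact mem_algebraicClosure_iff.mp (L.div_mem (hP a) (hP b))
  have hall' : Algebra.IsAlgebraic (Algebra.adjoin k s) (RatFun k) :=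
    IntermediateField.isAlgebraic_adjoin_iff_top.mp hall
  have hle := Algebra.IsAlgebraic.trdeg_le_cardinalMk k s
  have hX : AlgebraicIndependent k (fun i : Fin 3 => incl k (MvPolynomial.X i)) :=
    (MvPolynomial.algebraicIndependent_X (Fin 3) k).map'
      (IsFractionRing.injective (Poly k) (RatFun k))
  have h3 := hX.lift_cardinalMk_le_trdeg
  have hs : Cardinal.mk s ≤ 2 := by
    refine (Cardinal.mk_insert_le).trans ?_
    simp [one_add_one_eq_two]
  have h4 := h3.trans (Cardinal.lift_le.mpr (hle.trans hs))
  simp only [Cardinal.mk_fin, Cardinal.lift_natCast, Cardinal.lift_ofNat] at h4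
  exact absurd h4 (by norm_cast)

/-- The ring `C[r]`. -/
def ringCr (k : Type*) [Field k] (E : Exponents) : Subalgebra (ringC k E) (RatFun k) :=
  (Polynomial.aeval (R := ringC k E) (incl k (r k E))).range

/-- `C[r]` is the polynomial ring in `r` over `C`. -/
def polyEquivCr (k : Type*) [Field k] (E : Exponents) :
    Polynomial (ringC k E) ≃ₐ[ringC k E] ringCr k E :=
  AlgEquiv.ofInjective (Polynomial.aeval (R := ringC k E) (incl k (r k E)))
    (transcendental_iff_injective.mp (transcendental_r k E))

theorem r_mem (k : Type*) [Field k] (E : Exponents) : incl k (r k E) ∈ ringCr k E :=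
  ⟨Polynomial.X, by simp⟩

theorem incl_mem_ringCr (k : Type*) [Field k] (E : Exponents) (u : Poly k) :
    incl k u ∈ ringCr k E :=
  incl_mem_of_le E ((ringCr k E).restrictScalars k)
    (fun x hx => (ringCr k E).algebraMap_mem (⟨x, hx⟩ : ringC k E)) (r_mem k E) u

/-- The inclusion of `k[x₁, x₂, x₃]` into `C[r]`. -/
def inclCr (k : Type*) [Field k] (E : Exponents) : Poly k →ₐ[k] ringCr k E :=
  (incl k).codRestrict ((ringCr k E).restrictScalars k) (incl_mem_ringCr k E)

/-- The action `C[r] → C[r][T]`, `u(r) ↦ u(r + f ^ l g T)`, for `u` a polynomial over `C`. -/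
def actionCr (k : Type*) [Field k] (E : Exponents) :
    ringCr k E →ₐ[ringC k E] Polynomial (ringCr k E) :=
  (Polynomial.aeval (Polynomial.C (inclCr k E (r k E)) +
    Polynomial.C (inclCr k E (f k E ^ E.l * g k E)) * Polynomial.X)).comp
      (polyEquivCr k E).symm.toAlgHom

/-- The restriction of `actionCr` to `k[x₁, x₂, x₃]`, with values in `k(x₁, x₂, x₃)[T]`. -/
def actionRat (k : Type*) [Field k] (E : Exponents) : Poly k →ₐ[k] Polynomial (RatFun k) :=
  (Polynomial.mapAlgHom ((ringCr k E).val.restrictScalars k)).comp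
    (((actionCr k E).restrictScalars k).comp (inclCr k E))

/-- The inclusion of `k[x₁, x₂, x₃][T]` into `k(x₁, x₂, x₃)[T]`. -/
def inclPoly (k : Type*) [Field k] : Polynomial (Poly k) →ₐ[k] Polynomial (RatFun k) :=
  Polynomial.mapAlgHom (incl k)

theorem inclPoly_injective (k : Type*) [Field k] : Function.Injective (inclPoly k) :=
  Polynomial.map_injective _ (IsFractionRing.injective (Poly k) (RatFun k))

theorem actionRat_apply (k : Type*) [Field k] (E : Exponents) (u : Poly k) :
    actionRat k E u = (actionCr k E (inclCr k E u)).map (ringCr k E).val.toRingHom := rfl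

theorem inclPoly_apply (k : Type*) [Field k] (u : Polynomial (Poly k)) :
    inclPoly k u = u.map (incl k).toRingHom := rfl

theorem actionRat_of_mem (k : Type*) [Field k] (E : Exponents) (u : Poly k)
    (hu : incl k u ∈ ringC k E) : actionRat k E u = inclPoly k (Polynomial.C u) := by
  have h1 : inclCr k E u = algebraMap (ringC k E) (ringCr k E) ⟨incl k u, hu⟩ := rfl
  have h3 : algebraMap (ringC k E) (Polynomial (ringCr k E)) ⟨incl k u, hu⟩ =
      Polynomial.C (algebraMap (ringC k E) (ringCr k E) ⟨incl k u, hu⟩) := rfl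
  rw [actionRat_apply, inclPoly_apply, h1, AlgHom.commutes, h3, Polynomial.map_C,
    Polynomial.map_C]
  rfl

theorem actionRat_r (k : Type*) [Field k] (E : Exponents) :
    actionRat k E (r k E) = inclPoly k (Polynomial.C (r k E) +
      Polynomial.C (f k E ^ E.l * g k E) * Polynomial.X) := by
  have h1 : (polyEquivCr k E).symm (inclCr k E (r k E)) = Polynomial.X := by
    rw [AlgEquiv.symm_apply_eq]
    apply Subtype.ext
    change _ = Polynomial.aeval (R := ringC k E) (incl k (r k E)) Polynomial.X
    rw [Polynomial.aeval_X]
    rfl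
  have h2 : actionCr k E (inclCr k E (r k E)) = Polynomial.aeval
      (Polynomial.C (inclCr k E (r k E)) +
        Polynomial.C (inclCr k E (f k E ^ E.l * g k E)) * Polynomial.X)
        ((polyEquivCr k E).symm (inclCr k E (r k E))) := rfl
  rw [actionRat_apply, inclPoly_apply, h2, h1, Polynomial.aeval_X]
  simp only [Polynomial.map_add, Polynomial.map_mul, Polynomial.map_C, Polynomial.map_X]
  rfl

theorem prime_f (k : Type*) [Field k] (E : Exponents) : Prime (f k E) := by
  have ht : E.t ≠ 0 := by have := E.two_le_t; omega
  have h := MvPolynomial.irreducible_mul_X_add (R := k) (MvPolynomial.X (0 : Fin 3))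
    (-MvPolynomial.X 1 ^ E.t) 2 (by simp) (by simp [MvPolynomial.vars_X]) (by
      intro h2
      rw [MvPolynomial.vars_neg] at h2
      have := MvPolynomial.vars_pow _ _ h2
      simp [MvPolynomial.vars_X] at this) (by
      refine (Irreducible.isRelPrime_iff_not_dvd (MvPolynomial.X_prime (R := k) (i := (0 : Fin 3))).irreducible).mpr ?_
      rintro ⟨c, hc⟩
      have := congrArg (MvPolynomial.eval (![0, 1, 0] : Fin 3 → k)) hc
      simp at this)
  have h' : Irreducible (f k E) := by
    rw [f, sub_eq_add_neg]; exact h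
  exact h'.prime

theorem not_dvd (k : Type*) [Field k] (E : Exponents) (D : Polynomial (Poly k)) :
    ¬ Polynomial.C (f k E) ∣
      Polynomial.C (MvPolynomial.X 0) + Polynomial.C (f k E ^ E.l) * D := by
  intro h
  have hl : E.l ≠ 0 := by have := E.one_le_l; omega
  have h1 : Polynomial.C (f k E) ∣ Polynomial.C (f k E ^ E.l) * D :=
    Dvd.dvd.mul_right (map_dvd Polynomial.C (dvd_pow_self _ hl)) D
  have h2 := (dvd_add_left h1).mp h
  obtain ⟨c, hc⟩ := (Polynomial.C_dvd_iff_dvd_coeff _ _).mp h2 0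
  have := congrArg (MvPolynomial.eval (![1, 1, 1] : Fin 3 → k)) hc
  simp [f] at this

theorem actionRat_mem (k : Type*) [Field k] (E : Exponents) (u : Poly k) :
    actionRat k E u ∈ (inclPoly k).range := by
  have hinj := inclPoly_injective k
  obtain ⟨R, hR⟩ : ∃ R, R = Polynomial.C (r k E) +
      Polynomial.C (f k E ^ E.l * g k E) * Polynomial.X := ⟨_, rfl⟩
  have hr : actionRat k E (r k E) = inclPoly k R := by rw [hR]; exact actionRat_r k E
  have hf := actionRat_of_mem k E _ (f_mem k E)
  have hg := actionRat_of_mem k E _ (g_mem k E)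
  have hCf : Polynomial.C (f k E) ≠ 0 := by simpa using f_ne_zero k E
  have hCg : Polynomial.C (g k E) ≠ 0 := by simpa using g_ne_zero k E
  have e0 := congrArg (actionRat k E) (X_zero_mul_g k E)
  have e1 := congrArg (actionRat k E) (r_eq k E)
  have e2 := congrArg (actionRat k E) (f_eq k E)
  have e3 := congrArg (actionRat k E) (g_eq k E)
  simp only [map_mul, map_add, map_sub, map_pow, map_sum, map_natCast, hf, hg, hr]
    at e0 e1 e2 e3
  -- the image of the first variable
  obtain ⟨W, hW⟩ := sub_dvd_pow_sub_pow R (Polynomial.C (r k E)) E.t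
  have h0 : actionRat k E (MvPolynomial.X 0) = inclPoly k (Polynomial.C (MvPolynomial.X 0) +
      Polynomial.C (f k E ^ E.l) * (Polynomial.X * W)) := by
    refine mul_right_cancel₀ ((map_ne_zero_iff _ hinj).mpr hCg) ?_
    rw [e0]
    simp only [← map_mul, ← map_add, ← map_pow]
    congr 1
    have hx := congrArg Polynomial.C (X_zero_mul_g k E)
    simp only [map_mul, map_add, map_pow] at hx hW hR ⊢
    rw [hR] at hW ⊢
    linear_combination hW - hx
  obtain ⟨X0, hX0⟩ : ∃ X0, X0 = Polynomial.C (MvPolynomial.X 0) +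
      Polynomial.C (f k E ^ E.l) * (Polynomial.X * W) := ⟨_, rfl⟩
  rw [← hX0] at h0
  -- the image of the second variable
  obtain ⟨V, hV⟩ := sub_dvd_pow_sub_pow X0 (Polynomial.C (MvPolynomial.X 0)) E.m
  obtain ⟨X1, hX1⟩ : ∃ X1, X1 = Polynomial.C (MvPolynomial.X 1) +
      Polynomial.C (g k E) * Polynomial.X - Polynomial.X * W * V := ⟨_, rfl⟩
  have h1 : actionRat k E (MvPolynomial.X 1) = inclPoly k X1 := by
    refine mul_left_cancel₀ (pow_ne_zero E.l ((map_ne_zero_iff _ hinj).mpr hCf)) ?_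
    rw [h0] at e1
    rw [← sub_eq_iff_eq_add] at e1
    rw [← e1]
    simp only [← map_mul, ← map_sub, ← map_pow]
    congr 1
    have hx := congrArg Polynomial.C (r_eq k E)
    have hX0' : X0 - Polynomial.C (MvPolynomial.X 0) =
      Polynomial.C (f k E ^ E.l) * (Polynomial.X * W) := by rw [hX0]; ring
    rw [hX0'] at hV
    simp only [map_mul, map_add, map_pow] at hx hV hR ⊢
    rw [hR, hX1]
    linear_combination hx - hV
  -- the image of the third variable
  have h2 : actionRat k E (MvPolynomial.X 2) ∈ (inclPoly k).range := by
    rw [h0, h1] at e2 e3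
    obtain ⟨N, hN⟩ : ∃ N, N = Polynomial.C (g k E) -
      ∑ i ∈ Finset.range E.t, (Polynomial.C (f k E) ^ E.l * X1) ^ i *
        X0 ^ (E.m * (E.t - i) - 1) * (E.t.choose i : Polynomial (Poly k)) := ⟨_, rfl⟩
    have hN' : inclPoly k N = inclPoly k (Polynomial.C (f k E)) ^ (E.l * E.t) *
        actionRat k E (MvPolynomial.X 2) := by
      rw [hN, map_sub, e3]
      simp only [map_mul, map_pow, map_sum, map_natCast]
      ring
    have hdvd : Polynomial.C (f k E) ^ (E.l * E.t) ∣ X0 * N := by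
      refine ⟨Polynomial.C (f k E) + X1 ^ E.t, hinj ?_⟩
      have e2' := sub_eq_iff_eq_add.mp e2.symm
      rw [map_mul, hN', map_mul, map_add, map_pow, map_pow, ← e2']
      ring
    have hp : Prime (Polynomial.C (f k E)) := Polynomial.prime_C_iff.mpr (prime_f k E)
    obtain ⟨M, hM⟩ := hp.pow_dvd_of_dvd_mul_left _
      (by rw [hX0]; exact not_dvd k E _) hdvd
    refine ⟨M, mul_left_cancel₀
      (pow_ne_zero (E.l * E.t) ((map_ne_zero_iff _ hinj).mpr hCf)) ?_⟩
    rw [← hN', hM, map_mul, map_pow]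
    rfl
  induction u using MvPolynomial.induction_on with
  | C a =>
    have h : actionRat k E (MvPolynomial.C a) = algebraMap k _ a := (actionRat k E).commutes a
    rw [h]
    exact (inclPoly k).range.algebraMap_mem a
  | add p q hp hq => rw [map_add]; exact (inclPoly k).range.add_mem hp hq
  | mul_X p i hp =>
    rw [map_mul]
    refine (inclPoly k).range.mul_mem hp ?_
    fin_cases i
    · exact ⟨X0, h0.symm⟩
    · exact ⟨X1, h1.symm⟩
    · exact h2

/-- The `𝔾ₐ`-action `ε : k[x₁, x₂, x₃] → k[x₁, x₂, x₃][T]`, the restriction of `actionCr`. -/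
def action (k : Type*) [Field k] (E : Exponents) : Poly k →ₐ[k] Polynomial (Poly k) :=
  (AlgEquiv.ofInjective (inclPoly k) (inclPoly_injective k)).symm.toAlgHom.comp
    ((actionRat k E).codRestrict (inclPoly k).range (actionRat_mem k E))

theorem inclPoly_action (k : Type*) [Field k] (E : Exponents) (u : Poly k) :
    inclPoly k (action k E u) = actionRat k E u :=
  congrArg Subtype.val ((AlgEquiv.ofInjective (inclPoly k) (inclPoly_injective k)).apply_symm_apply
    ((actionRat k E).codRestrict (inclPoly k).range (actionRat_mem k E) u))

/-- The ring `k[x₁, x₂, x₃]^ε` of all `u` with `ε(u) = u`. -/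
def actionInvariants (k : Type*) [Field k] (E : Exponents) : Subalgebra k (Poly k) :=
  AlgHom.equalizer (action k E) (Polynomial.CAlgHom (R := k) (A := Poly k))

/-- The map `ε_h : u ↦ ε(u)|_{T = h}` of `k[x₁, x₂, x₃]`. -/
def expAut (k : Type*) [Field k] (E : Exponents) (h : Poly k) : Poly k →ₐ[k] Poly k :=
  ((Polynomial.aeval (R := Poly k) h).restrictScalars k).comp (action k E)

/-- The ring `k[x₁, x₂, x₃]^{ε_h}` of all `u` with `ε_h(u) = u`. -/
def expInvariants (k : Type*) [Field k] (E : Exponents) (h : Poly k) : Subalgebra k (Poly k) :=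
  AlgHom.equalizer (expAut k E h) (AlgHom.id k (Poly k))

/-- `q = r ^ p - (f ^ l g h) ^ (p - 1) r`. -/
def q (k : Type*) [Field k] (E : Exponents) (p : ℕ) (h : Poly k) : Poly k :=
  r k E ^ p - (f k E ^ E.l * g k E * h) ^ (p - 1) * r k E

/-- `q₁ = g⁻¹ (f ^ (l t + 1) + q ^ (t / p))`, as an element of `k(x₁, x₂, x₃)`. -/
def q₁ (k : Type*) [Field k] (E : Exponents) (p : ℕ) (h : Poly k) : RatFun k :=
  (incl k (g k E))⁻¹ * incl k (f k E ^ (E.l * E.t + 1) + q k E p h ^ (E.t / p))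

/-- The ring `C[r ^ p]`. -/
def ringCrp (k : Type*) [Field k] (E : Exponents) (p : ℕ) : Subalgebra (ringC k E) (RatFun k) :=
  (Polynomial.aeval (R := ringC k E) (incl k (r k E) ^ p)).range

/-- `C[r ^ p]` is the polynomial ring in `r ^ p` over `C`. -/
def polyEquivCrp (k : Type*) [Field k] (E : Exponents) (p : ℕ) (hp : 0 < p) :
    Polynomial (ringC k E) ≃ₐ[ringC k E] ringCrp k E p :=
  AlgEquiv.ofInjective (Polynomial.aeval (R := ringC k E) (incl k (r k E) ^ p))
    (transcendental_iff_injective.mp ((transcendental_r k E).pow hp))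

/-- The map `ψ : C[r ^ p] → C[q] ⊆ k(x₁, x₂, x₃)`, `u(r ^ p) ↦ u(q)`, for `u` a polynomial
over `C`. -/
def psi (k : Type*) [Field k] (E : Exponents) (p : ℕ) (hp : 0 < p) (h : Poly k) :
    ringCrp k E p →ₐ[ringC k E] RatFun k :=
  (Polynomial.aeval (R := ringC k E) (incl k (q k E p h))).comp
    (polyEquivCrp k E p hp).symm.toAlgHom

end

end RankThree

/-!
After inverting `f` and `g`, the ring `k[x₁, x₂, x₃]` becomes `C[r]`, where invariants are visible:
`ε` and `ε_h` translate `r` by `f ^ l g T` and by `b = f ^ l g h`. A polynomial in `r` fixed by the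
first is constant. Over a ring containing `b` and `q = r ^ p - b ^ (p - 1) r`, every polynomial in
`r` has a representative of degree less than `p`; if it is fixed by `r ↦ r + b`, it takes the same
value at the `p` points `r + j b`, hence is constant. So a ring `D` of invariants of `ε_h` is the
whole ring of invariants as soon as it contains `f`, `g`, `h`, `q`, `q₁` and is saturated at `f`:
`f u ∈ D` implies `u ∈ D`. This is checked on the surface `f = 0`, parametrized by
`(y, y z, y ^ (t - 1) z ^ t)`: for `D = k[q₁, q₂, q₃]` with `q₁ q₃ - q₂ ^ (t / p) = f` it suffices
that `q₁`, which restricts to `y`, and `q₂` are algebraically independent there. In the same way,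
`k[f, g]` is the ring of invariants of `ε`, because it is saturated at `f` and at `g`; for `g` one
restricts to the line `x₁ = x₃ = 0`, where `g` vanishes since `p ∣ t`.

To find `q₂`, one writes `q = q₁ c + f ^ (l p) q₂` with `c ∈ k[f, q₁]`, starting from
`r ^ p = x₁ ^ (m p) + f ^ (l p) x₂ ^ p` and `x₁ ≡ q₁` modulo `f ^ l`. The term `b ^ (p - 1) r` of
`q` only has the visible factor `f ^ (l (p - 1))`; reducing `(g h) ^ (p - 1) r` modulo `f ^ l` to a
multiple of `q₁` supplies the missing one. The map `ψ` sends `x₂ ^ p` to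
`f ^ (-l p) (q - q₁ ^ (m p))`, so the question in (ii) is whether no such correction is needed, that
is, whether `f ^ l` divides `h ^ (p - 1)`.
-/

namespace RankThree

open Polynomial

section Subalgebra

variable {k A : Type*} [CommRing k] [CommRing A] [Algebra k A] {S T : Subalgebra k A}

/-- A subalgebra is saturated at `a` if it contains the quotients by `a` of its elements. -/
def IsSaturated (S : Subalgebra k A) (a : A) : Prop :=
  ∀ ⦃u : A⦄, a * u ∈ S → u ∈ S

theorem IsSaturated.mem_of_mem_closure {s : Set A} (hS : ∀ a ∈ s, IsSaturated S a) {b u : A}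
    (hb : b ∈ Submonoid.closure s) (hu : b * u ∈ S) : u ∈ S := by
  induction hb using Submonoid.closure_induction generalizing u with
  | mem a ha => exact hS a ha hu
  | one => rwa [one_mul] at hu
  | mul a b _ _ iha ihb => exact ihb (iha (by rwa [← mul_assoc]))

theorem IsSaturated.mem_of_pow_mul_mem {a u : A} (hS : IsSaturated S a) (n : ℕ)
    (hu : a ^ n * u ∈ S) : u ∈ S :=
  mem_of_mem_closure (s := {a}) (by simpa using hS)
    (pow_mem (Submonoid.mem_closure_singleton_self) n) hu

theorem isSaturated_equalizer {B : Type*} [CommRing B] [IsDomain B] [Algebra k B]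
    {φ ψ : A →ₐ[k] B} {a : A} (ha : a ∈ AlgHom.equalizer φ ψ) (ha0 : ψ a ≠ 0) :
    IsSaturated (AlgHom.equalizer φ ψ) a := by
  intro u hu
  rw [AlgHom.mem_equalizer] at ha hu ⊢
  rw [map_mul, map_mul, ha] at hu
  exact mul_left_cancel₀ ha0 hu

theorem isSaturated_saturation {M : Submonoid A} {hM : M ≤ S.toSubmonoid} {a : A} (ha : a ∈ M) :
    IsSaturated (S.saturation M hM) a :=
  fun _ hu => Subalgebra.mem_saturation_of_mul_mem_left hu ha

theorem geom_sum_mem {a b : A} (ha : a ∈ S) (hb : b ∈ S) (n : ℕ) :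
    ∑ i ∈ Finset.range n, a ^ i * b ^ (n - 1 - i) ∈ S :=
  sum_mem fun _ _ => mul_mem (pow_mem ha _) (pow_mem hb _)

theorem exists_pow_eq_add_mul {a b c w : A} (ha : a ∈ S) (hb : b ∈ S) (hw : w ∈ S)
    (h : a = b + c * w) (n : ℕ) : ∃ v ∈ S, a ^ n = b ^ n + c * v := by
  refine ⟨_, mul_mem (geom_sum_mem ha hb n) hw, ?_⟩
  linear_combination -geom_sum₂_mul a b n +
    (∑ i ∈ Finset.range n, a ^ i * b ^ (n - 1 - i)) * h

theorem exists_eq_add_mul_of_mem_adjoin (hTS : T ≤ S) {c : A} (hc : c ∈ S) {s : Set A}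
    (hs : ∀ x ∈ s, ∃ a ∈ T, ∃ v ∈ S, x = a + c * v) {x : A} (hx : x ∈ Algebra.adjoin k s) :
    ∃ a ∈ T, ∃ v ∈ S, x = a + c * v := by
  induction hx using Algebra.adjoin_induction with
  | mem x hx => exact hs x hx
  | algebraMap z => exact ⟨_, T.algebraMap_mem z, 0, zero_mem _, by ring⟩
  | add x y _ _ hx hy =>
    obtain ⟨a, ha, v, hv, rfl⟩ := hx
    obtain ⟨b, hb, w, hw, rfl⟩ := hy
    exact ⟨_, add_mem ha hb, _, add_mem hv hw, by ring⟩
  | mul x y _ _ hx hy =>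
    obtain ⟨a, ha, v, hv, rfl⟩ := hx
    obtain ⟨b, hb, w, hw, rfl⟩ := hy
    exact ⟨_, mul_mem ha hb, a * w + b * v + c * (v * w), add_mem (add_mem
      (mul_mem (hTS ha) hw) (mul_mem (hTS hb) hv)) (mul_mem hc (mul_mem hv hw)), by ring⟩

theorem isSaturated_adjoin_pair [IsDomain A] {B : Type*} [CommRing B] [Algebra k B]
    (φ : A →ₐ[k] B) {c d : A} (hc : c ≠ 0) (hφc : φ c = 0) (hφd : Transcendental k (φ d)) :
    IsSaturated (Algebra.adjoin k {c, d}) c := by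
  intro u hu
  have hcS : c ∈ Algebra.adjoin k {c, d} := Algebra.subset_adjoin (by simp)
  obtain ⟨a, ha, v, hv, huv⟩ := exists_eq_add_mul_of_mem_adjoin
    (Algebra.adjoin_mono (show {d} ⊆ ({c, d} : Set A) by simp)) hcS (by
      rintro x (rfl | rfl)
      · exact ⟨0, zero_mem _, 1, one_mem _, by ring⟩
      · exact ⟨x, Algebra.subset_adjoin rfl, 0, zero_mem _, by ring⟩) hu
  obtain ⟨P, rfl⟩ := Algebra.adjoin_singleton_eq_range_aeval k d ▸ ha
  have hP : aeval (φ d) P = 0 := by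
    simpa [hφc, aeval_algHom_apply] using (congrArg φ huv).symm
  rw [transcendental_iff.mp hφd P hP, map_zero, zero_add] at huv
  rwa [mul_left_cancel₀ hc huv]

theorem le_of_saturation_adjoin_eq_top {D B : Subalgebra k A} {s : Set A} {r : A}
    {hs : Submonoid.closure s ≤ ((Algebra.adjoin D {r}).restrictScalars k).toSubmonoid}
    (htop : ((Algebra.adjoin D {r}).restrictScalars k).saturation (.closure s) hs = ⊤)
    (hsB : s ⊆ B) (hD : ∀ a ∈ s, IsSaturated D a)
    (hDr : ∀ x ∈ Algebra.adjoin D {r}, x ∈ B → x ∈ D) : B ≤ D := by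
  intro u hu
  obtain ⟨m, hm, hmu⟩ : u ∈ ((Algebra.adjoin D {r}).restrictScalars k).saturation _ hs :=
    htop ▸ Algebra.mem_top
  have hmB : m ∈ B := Submonoid.closure_le (S := B.toSubmonoid).mpr hsB hm
  exact IsSaturated.mem_of_mem_closure hD hm (hDr _ hmu (mul_mem hmB hu))

theorem isAlgebraic_of_saturation_adjoin_eq_top [IsDomain A] {D : Subalgebra k A} {s : Set A}
    {r : A} {hs : Submonoid.closure s ≤ ((Algebra.adjoin D {r}).restrictScalars k).toSubmonoid}
    (htop : ((Algebra.adjoin D {r}).restrictScalars k).saturation (.closure s) hs = ⊤)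
    (hsD : s ⊆ D) (h0 : 0 ∉ s) (hr : IsAlgebraic D r) : Algebra.IsAlgebraic D A := by
  refine ⟨fun u => ?_⟩
  obtain ⟨m, hm, hmu⟩ : u ∈ ((Algebra.adjoin D {r}).restrictScalars k).saturation _ hs :=
    htop ▸ Algebra.mem_top
  have hmD : m ∈ D := Submonoid.closure_le (S := D.toSubmonoid).mpr hsD hm
  have hm0 : m ∈ nonZeroDivisors A := Submonoid.closure_le.mpr
    (fun a ha => mem_nonZeroDivisors_of_ne_zero (ne_of_mem_of_not_mem ha h0)) hm
  exact (isAlgebraic_algebraMap (⟨m, hmD⟩ : D)).of_mul hm0 (Algebra.adjoin_le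
    (S := Subalgebra.algebraicClosure D A) (Set.singleton_subset_iff.mpr hr) hmu)

end Subalgebra

theorem mul_sub_mul_geom_sum {A : Type*} [CommRing A] {a b c d e g : A} {s : ℕ}
    (hg : a * g = e + d ^ s) (hb : b = d - a * c) :
    a * (g - c * ∑ i ∈ Finset.range s, b ^ i * d ^ (s - 1 - i)) = e + b ^ s := by
  linear_combination hg + geom_sum₂_mul b d s -
    (∑ i ∈ Finset.range s, b ^ i * d ^ (s - 1 - i)) * hb

theorem range_fin_three {α : Type*} (x : Fin 3 → α) : Set.range x = {x 0, x 1, x 2} := by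
  ext
  simp [Fin.exists_fin_succ, eq_comm]

section Translation

variable {R A : Type*} [CommRing R] [CommRing A] [Algebra R A] {p : ℕ} {r : A}

theorem mem_range_algebraMap_of_map_eq_C [IsDomain A] {δ : A →ₐ[R] A[X]} {b : A} (hb : b ≠ 0)
    (hr : δ r = C r + C b * X) {x : A} (hx : x ∈ Algebra.adjoin R {r}) (hδx : δ x = C x) :
    x ∈ (algebraMap R A).range := by
  obtain ⟨U, rfl⟩ : ∃ U : R[X], aeval r U = x := by
    rwa [Algebra.adjoin_singleton_eq_range_aeval] at hx
  have hcomp : (U.map (algebraMap R A)).comp (C b * X + C r) = C (aeval r U) := by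
    rw [← hδx, ← aeval_algHom_apply, hr, add_comm, comp, eval₂_map]
    rfl
  have hdeg : (U.map (algebraMap R A)).natDegree = 0 := by
    simpa [natDegree_comp, natDegree_linear hb] using congrArg natDegree hcomp
  refine ⟨U.coeff 0, ?_⟩
  rw [eq_C_of_natDegree_eq_zero hdeg, C_comp, coeff_map] at hcomp
  exact C_injective hcomp

theorem eq_C_of_forall_eval_add_natCast_mul_eq [IsDomain A] [CharP A p] {V : A[X]}
    (hV : V.natDegree < p)
    {b x : A} (hb : b ≠ 0) (h : ∀ j : ℕ, V.eval (r + j * b) = x) : V = C x := by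
  refine sub_eq_zero.mp (eq_zero_of_natDegree_lt_card_of_eval_eq_zero _ (ι := Fin p)
    (f := fun j => r + ((j : ℕ) : A) * b) (fun i j hij => ?_) (fun j => ?_) ?_)
  · exact Fin.ext (CharP.natCast_injOn_Iio A p i.2 j.2 (mul_right_cancel₀ hb (add_left_cancel hij)))
  · rw [eval_sub, eval_C, h, sub_self]
  · rwa [natDegree_sub_C, Fintype.card_fin]

theorem exists_monic_natDegree_eq [Nontrivial R] (hp : 1 < p) {b c : R}
    (hr : r ^ p - algebraMap R A b * r = algebraMap R A c) :
    ∃ Q : R[X], Q.Monic ∧ Q.natDegree = p ∧ aeval r Q = 0 := by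
  have hdeg : (C b * X + C c).degree < (p : WithBot ℕ) :=
    degree_linear_le.trans_lt (by exact_mod_cast hp)
  refine ⟨X ^ p - (C b * X + C c), monic_X_pow_sub hdeg, natDegree_eq_of_degree_eq_some ?_, ?_⟩
  · rw [degree_sub_eq_left_of_degree_lt (by rwa [degree_X_pow]), degree_X_pow]
  · simp only [map_sub, map_add, map_mul, map_pow, aeval_X, aeval_C]
    linear_combination hr

theorem mem_range_algebraMap_of_map_eq [IsDomain A] [CharP A p] (hp : 1 < p)
    {σ : A →ₐ[R] A} {b c : R}
    (hb : algebraMap R A b ≠ 0) (hσ : σ r = r + algebraMap R A b)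
    (hr : r ^ p - algebraMap R A (b ^ (p - 1)) * r = algebraMap R A c) {x : A}
    (hx : x ∈ Algebra.adjoin R {r}) (hσx : σ x = x) : x ∈ (algebraMap R A).range := by
  have : Nontrivial R := ⟨b, 0, fun h => hb (by rw [h, map_zero])⟩
  obtain ⟨U, rfl⟩ : ∃ U : R[X], aeval r U = x := by
    rwa [Algebra.adjoin_singleton_eq_range_aeval] at hx
  obtain ⟨Q, hQ, hQp, hroot⟩ := exists_monic_natDegree_eq hp hr
  rw [← aeval_modByMonic_eq_self_of_root hroot] at hσx ⊢
  set V := U %ₘ Q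
  have hVp : V.natDegree < p :=
    (natDegree_modByMonic_lt U hQ (by rintro rfl; simp at hQp; omega)).trans_eq hQp
  have htranslate : ∀ j : ℕ, aeval (r + j * algebraMap R A b) V = aeval r V := by
    intro j
    induction j with
    | zero => simp
    | succ j ih =>
      rw [← hσx, ← ih, ← aeval_algHom_apply, map_add, map_mul, hσ, map_natCast, σ.commutes]
      congr 2
      push_cast
      ring
  have hconst := eq_C_of_forall_eval_add_natCast_mul_eq (V := V.map (algebraMap R A))
    (natDegree_map_le.trans_lt hVp) hb fun j => by rw [eval_map_algebraMap, htranslate j]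
  exact ⟨V.coeff 0, by rw [← coeff_map, hconst, coeff_C_zero]⟩

end Translation

section AlgebraicIndependence

variable {k : Type*} [CommRing k]

theorem algebraicIndependent_of_isAlgebraic_adjoin [IsDomain k] {ι : Type*} [Finite ι]
    {x : ι → MvPolynomial ι k}
    (hx : Algebra.IsAlgebraic (Algebra.adjoin k (Set.range x)) (MvPolynomial ι k)) :
    AlgebraicIndependent k x :=
  (Algebra.IsAlgebraic.isTranscendenceBasis_of_lift_le_trdeg_of_finite k x
    (by rw [MvPolynomial.trdeg_of_isDomain]; simp)).1

theorem algebraicIndependent_C_X_of_natDegree_pos [IsDomain k] {b : k[X][X]}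
    (hb : 0 < b.natDegree) :
    AlgebraicIndependent k ![C X, b] := by
  have htr := Polynomial.transcendental b hb.ne'
    (mem_nonZeroDivisors_of_ne_zero (leadingCoeff_ne_zero.mpr (by rintro rfl; simp at hb)))
  have hcomp : MvPolynomial.aeval ![C X, b] =
      ((aeval b).restrictScalars k).comp (Bivariate.equivMvPolynomial k).symm.toAlgHom := by
    ext i : 1
    fin_cases i <;> simp
  rw [AlgebraicIndependent, hcomp]
  exact (transcendental_iff_injective.mp htr).comp (Bivariate.equivMvPolynomial k).symm.injective

theorem exists_dvd_X_pow_mul_sub (s : ℕ) (P : MvPolynomial (Fin 3) k) :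
    ∃ n : ℕ, ∃ Q : MvPolynomial (Fin 2) k,
      MvPolynomial.X 0 * MvPolynomial.X 2 - MvPolynomial.X 1 ^ s ∣
        MvPolynomial.X 0 ^ n * P - MvPolynomial.aeval ![MvPolynomial.X 0, MvPolynomial.X 1] Q := by
  set F : MvPolynomial (Fin 3) k :=
    MvPolynomial.X 0 * MvPolynomial.X 2 - MvPolynomial.X 1 ^ s with hF
  let T : Subalgebra k (MvPolynomial (Fin 3) k) :=
    (MvPolynomial.aeval ![MvPolynomial.X 0, MvPolynomial.X 1]).range
  let mod := Ideal.Quotient.mkₐ k (Ideal.span {F})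
  have h0 : MvPolynomial.X 0 ∈ T := ⟨MvPolynomial.X 0, by simp⟩
  have h1 : MvPolynomial.X 1 ∈ T := ⟨MvPolynomial.X 1, by simp⟩
  let S := (T.map mod).comap mod
  have hTS : T ≤ S := fun Q hQ => ⟨Q, hQ, rfl⟩
  have hX : Submonoid.closure {MvPolynomial.X 0} ≤ S.toSubmonoid := by simpa using hTS h0
  have htop : S.saturation _ hX = ⊤ := by
    rw [eq_top_iff, ← MvPolynomial.adjoin_range_X, range_fin_three]
    refine Algebra.adjoin_le ?_
    rintro _ (rfl | rfl | rfl)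
    · exact Subalgebra.le_saturation (hTS h0)
    · exact Subalgebra.le_saturation (hTS h1)
    · refine isSaturated_saturation Submonoid.mem_closure_singleton_self
        (Subalgebra.le_saturation ⟨MvPolynomial.X 1 ^ s, pow_mem h1 s, ?_⟩)
      exact Ideal.Quotient.eq.mpr (Ideal.mem_span_singleton.mpr ⟨-1, by rw [hF]; ring⟩)
  obtain ⟨m, hm, _, ⟨Q, rfl⟩, hQ⟩ : P ∈ S.saturation _ hX := htop ▸ Algebra.mem_top
  obtain ⟨n, rfl⟩ := Submonoid.mem_closure_singleton.mp hm
  exact ⟨n, Q, Ideal.mem_span_singleton.mp (Ideal.Quotient.eq.mp hQ.symm)⟩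

theorem X_mul_X_sub_dvd_of_aeval_eq_zero [IsDomain k] [UniqueFactorizationMonoid k]
    {B : Type*} [CommRing B] [Algebra k B]
    {y : Fin 3 → B} {s : ℕ} (hy : y 0 * y 2 = y 1 ^ s)
    (hind : AlgebraicIndependent k ![y 0, y 1]) {P : MvPolynomial (Fin 3) k}
    (hP : MvPolynomial.aeval y P = 0) :
    MvPolynomial.X 0 * MvPolynomial.X 2 - MvPolynomial.X 1 ^ s ∣ P := by
  obtain ⟨n, Q, W, hW⟩ := exists_dvd_X_pow_mul_sub s P
  have hQ := congrArg (MvPolynomial.aeval y) hW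
  have hvec : (fun i => MvPolynomial.aeval y ((![MvPolynomial.X 0, MvPolynomial.X 1] :
      Fin 2 → MvPolynomial (Fin 3) k) i)) = ![y 0, y 1] := by
    ext i
    fin_cases i <;> simp
  simp only [map_sub, map_mul, map_pow, hP, MvPolynomial.comp_aeval_apply, hvec,
    MvPolynomial.aeval_X, hy, sub_self, zero_mul, mul_zero, zero_sub, neg_eq_zero] at hQ
  rw [hind.eq_zero_of_aeval_eq_zero _ hQ, map_zero, sub_zero] at hW
  refine IsRelPrime.dvd_of_dvd_mul_left (IsRelPrime.pow_right ?_) ⟨W, hW⟩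
  refine (MvPolynomial.X_prime.irreducible.isRelPrime_iff_not_dvd.mpr ?_).symm
  rintro ⟨c, hc⟩
  simpa using congrArg (MvPolynomial.eval (![0, 1, 0] : Fin 3 → k)) hc

theorem isSaturated_adjoin_range [IsDomain k] [UniqueFactorizationMonoid k] {A B : Type*}
    [CommRing A] [IsDomain A] [Algebra k A] [CommRing B] [Algebra k B] (φ : A →ₐ[k] B)
    {x : Fin 3 → A} {c : A} {s : ℕ}
    (hxc : x 0 * x 2 - x 1 ^ s = c) (hc : c ≠ 0) (hφc : φ c = 0)
    (hind : AlgebraicIndependent k ![φ (x 0), φ (x 1)]) :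
    IsSaturated (Algebra.adjoin k (Set.range x)) c := by
  intro u hu
  rw [Algebra.adjoin_range_eq_range_aeval] at hu ⊢
  obtain ⟨P, hP⟩ : ∃ P, MvPolynomial.aeval x P = c * u := hu
  obtain ⟨V, rfl⟩ := X_mul_X_sub_dvd_of_aeval_eq_zero (y := φ ∘ x) (s := s) (P := P)
    (by simpa [← hxc, sub_eq_zero] using hφc) hind
    (by rw [Function.comp_def, ← MvPolynomial.comp_aeval_apply, hP, map_mul, hφc, zero_mul])
  refine ⟨V, mul_left_cancel₀ hc ?_⟩
  simpa [hxc] using hP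

end AlgebraicIndependence

section Action

variable {k : Type*} [Field k] {E : Exponents} {h : Poly k}

theorem mem_actionInvariants_of_incl_mem {u : Poly k} (hu : incl k u ∈ ringC k E) :
    u ∈ actionInvariants k E :=
  inclPoly_injective k ((inclPoly_action k E u).trans (actionRat_of_mem k E u hu))

theorem adjoin_f_g_le_actionInvariants :
    Algebra.adjoin k {f k E, g k E} ≤ actionInvariants k E := by
  refine Algebra.adjoin_le ?_
  rintro _ (rfl | rfl)
  · exact mem_actionInvariants_of_incl_mem (f_mem k E)
  · exact mem_actionInvariants_of_incl_mem (g_mem k E)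

theorem action_r : action k E (r k E) = C (r k E) + C (f k E ^ E.l * g k E) * X :=
  inclPoly_injective k ((inclPoly_action k E _).trans (actionRat_r k E))

theorem expAut_apply (u : Poly k) : expAut k E h u = (action k E u).eval h := by
  simp [expAut]

theorem expAut_r : expAut k E h (r k E) = r k E + f k E ^ E.l * g k E * h := by
  simp [expAut_apply, action_r]

theorem actionInvariants_le_expInvariants : actionInvariants k E ≤ expInvariants k E h := by
  intro u hu
  change expAut k E h u = u
  rw [expAut_apply, show action k E u = C u from hu, eval_C]

theorem isSaturated_expInvariants {a : Poly k} (ha : a ∈ expInvariants k E h) (ha0 : a ≠ 0) :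
    IsSaturated (expInvariants k E h) a :=
  isSaturated_equalizer ha ha0

end Action

section Generation

variable {k : Type*} [Field k] {E : Exponents}

theorem eq_top_of_isSaturated {S : Subalgebra k (Poly k)} (hS : IsSaturated S (f k E))
    (hf : f k E ∈ S) (hg : g k E ∈ S) (hr : r k E ∈ S) (h0 : MvPolynomial.X 0 ∈ S) : S = ⊤ := by
  have h1 : MvPolynomial.X 1 ∈ S := by
    refine hS.mem_of_pow_mul_mem E.l ?_
    rw [← sub_eq_iff_eq_add.mpr (r_eq k E)]
    exact sub_mem hr (pow_mem h0 _)
  have h2 : MvPolynomial.X 2 ∈ S := by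
    refine hS.mem_of_pow_mul_mem (E.l * E.t) ?_
    rw [← sub_eq_iff_eq_add.mpr (g_eq k E)]
    exact sub_mem hg (sum_mem fun i _ => mul_mem (mul_mem (pow_mem (mul_mem (pow_mem hf _) h1) _)
      (pow_mem h0 _)) (natCast_mem S _))
  rw [eq_top_iff, ← MvPolynomial.adjoin_range_X, range_fin_three]
  exact Algebra.adjoin_le (by rintro _ (rfl | rfl | rfl) <;> assumption)

end Generation

section Reduction

variable (k : Type*) [Field k] (E : Exponents)

/-- The parametrization `(x₁, x₂, x₃) ↦ (y, y z, y ^ (t - 1) z ^ t)` of the surface `f = 0`, as a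
homomorphism `k[x₁, x₂, x₃] → k[y][z]`. -/
noncomputable def param : Poly k →ₐ[k] k[X][X] :=
  MvPolynomial.aeval ![C X, C X * X, C (X ^ (E.t - 1)) * X ^ E.t]

theorem param_X_zero : param k E (MvPolynomial.X 0) = C X := by simp [param]

theorem param_X_one : param k E (MvPolynomial.X 1) = C X * X := by simp [param]

theorem param_f : param k E (f k E) = 0 := by
  have ht : E.t - 1 + 1 = E.t := Nat.sub_add_cancel (one_le_two.trans E.two_le_t)
  have hX : (C X : k[X][X]) * C (X ^ (E.t - 1)) = C X ^ E.t := by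
    rw [← C_mul, ← C_pow, ← pow_succ', ht]
  simp only [f_eq, param, map_sub, map_mul, map_pow, MvPolynomial.aeval_X, Matrix.cons_val]
  rw [← map_pow, ← mul_assoc, hX, mul_pow, sub_self]

theorem param_r : param k E (r k E) = C (X ^ E.m) := by
  simp [r_eq, param_f, param_X_zero, Nat.one_le_iff_ne_zero.mp E.one_le_l]

theorem param_g : param k E (g k E) = C (X ^ (E.m * E.t - 1)) := by
  have h := congrArg (param k E) (X_zero_mul_g k E)
  simp only [map_mul, map_add, map_pow, param_f, param_r, param_X_zero, ← pow_mul,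
    zero_pow (Nat.succ_ne_zero _), zero_add] at h
  refine mul_left_cancel₀ (C_ne_zero.mpr X_ne_zero) (h.trans ?_)
  rw [← C_pow, ← C_mul, mul_pow_sub_one (by have := E.three_le_mt; omega)]

theorem transcendental_param_g : Transcendental k (param k E (g k E)) := by
  rw [param_g]
  exact (transcendental_algebraMap_iff (R := k) (S := k[X]) (A := k[X][X]) C_injective).mpr
    ((Polynomial.transcendental_X k).pow (by have := E.three_le_mt; omega))

variable {k E} in
theorem not_f_dvd {u : Poly k} (hu : param k E u ≠ 0) : ¬ f k E ∣ u := by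
  rintro ⟨v, rfl⟩
  exact hu (by rw [map_mul, param_f, zero_mul])

/-- The ring of elements of `k[x₁, x₂, x₃]` whose restriction to the surface `f = 0` is a
polynomial in `x₁`. -/
noncomputable def baseRing : Subalgebra k (Poly k) :=
  (Polynomial.CAlgHom (R := k) (A := k[X])).range.comap (param k E)

theorem X_zero_mem_baseRing : MvPolynomial.X 0 ∈ baseRing k E := ⟨X, (param_X_zero k E).symm⟩

theorem f_mul_mem_baseRing (u : Poly k) : f k E * u ∈ baseRing k E :=
  ⟨0, by simp [param_f]⟩

theorem f_mem_baseRing : f k E ∈ baseRing k E := by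
  simpa using f_mul_mem_baseRing k E 1

theorem g_mem_baseRing : g k E ∈ baseRing k E := ⟨_, (param_g k E).symm⟩

theorem r_mem_baseRing : r k E ∈ baseRing k E := ⟨_, (param_r k E).symm⟩

theorem adjoin_f_g_le_baseRing : Algebra.adjoin k {f k E, g k E} ≤ baseRing k E := by
  refine Algebra.adjoin_le ?_
  rintro _ (rfl | rfl)
  · exact f_mem_baseRing k E
  · exact g_mem_baseRing k E

end Reduction

section ActionInvariants

variable {k : Type*} [Field k] {E : Exponents}

variable (k) in
/-- The restriction to the line `x₁ = x₃ = 0`, as a homomorphism `k[x₁, x₂, x₃] → k[y]`. -/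
noncomputable def line : Poly k →ₐ[k] k[X] := MvPolynomial.aeval ![0, X, 0]

theorem line_g (ht : (E.t : k) = 0) : line k (g k E) = 0 := by
  have ht' : (E.t : k[X]) = 0 := by rw [← C_eq_natCast, ht, C_0]
  simp only [g_eq, line, map_add, map_mul, map_pow, map_sum, map_natCast, MvPolynomial.aeval_X,
    Matrix.cons_val, mul_zero, zero_add]
  refine Finset.sum_eq_zero fun i hi => ?_
  rcases Nat.eq_zero_or_pos (E.m * (E.t - i) - 1) with hexp | hexp
  · have hit : E.t - i = 1 :=
      Nat.eq_one_of_mul_eq_one_left (show E.m * (E.t - i) = 1 by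
        have := Nat.mul_pos E.one_le_m (Nat.sub_pos_of_lt (Finset.mem_range.mp hi))
        omega)
    rw [← Nat.choose_symm (Finset.mem_range.mp hi).le, hit, Nat.choose_one_right, ht', mul_zero]
  · rw [zero_pow hexp.ne', mul_zero, zero_mul]

theorem transcendental_line_f : Transcendental k (line k (f k E)) := by
  have hf : line k (f k E) = -X ^ E.t := by simp [line, f_eq]
  rw [hf]
  exact fun h => (Polynomial.transcendental_X k).pow (n := E.t) (by have := E.two_le_t; omega)
    (by simpa using h.neg)

theorem isSaturated_adjoin_f_g_f : IsSaturated (Algebra.adjoin k {f k E, g k E}) (f k E) :=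
  isSaturated_adjoin_pair (param k E) (f_ne_zero k E) (param_f k E) (transcendental_param_g k E)

theorem isSaturated_adjoin_f_g_g (ht : (E.t : k) = 0) :
    IsSaturated (Algebra.adjoin k {f k E, g k E}) (g k E) := by
  rw [Set.pair_comm]
  exact isSaturated_adjoin_pair (line k) (g_ne_zero k E) (line_g ht) transcendental_line_f

theorem saturation_f_g_eq_top {S : Subalgebra k (Poly k)} (hr : r k E ∈ S)
    (hfg : Submonoid.closure {f k E, g k E} ≤ S.toSubmonoid) : S.saturation _ hfg = ⊤ := by
  have hf : f k E ∈ Submonoid.closure {f k E, g k E} := Submonoid.subset_closure (by simp)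
  have hg : g k E ∈ Submonoid.closure {f k E, g k E} := Submonoid.subset_closure (by simp)
  have hle : S ≤ S.saturation _ hfg := Subalgebra.le_saturation
  refine eq_top_of_isSaturated (isSaturated_saturation hf) (hle (hfg hf)) (hle (hfg hg))
    (hle hr) (isSaturated_saturation hg (hle ?_))
  rw [mul_comm, X_zero_mul_g]
  exact add_mem (pow_mem (hfg hf) _) (pow_mem hr _)

theorem actionInvariants_eq (ht : (E.t : k) = 0) :
    actionInvariants k E = Algebra.adjoin k {f k E, g k E} := by
  have hle := adjoin_f_g_le_actionInvariants (k := k) (E := E)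
  set D := Algebra.adjoin k {f k E, g k E}
  have hr : r k E ∈ (Algebra.adjoin D {r k E}).restrictScalars k :=
    Algebra.self_mem_adjoin_singleton D (r k E)
  have hfgD : {f k E, g k E} ⊆ (D : Set (Poly k)) := Algebra.subset_adjoin
  have hclosure : Submonoid.closure {f k E, g k E} ≤
      ((Algebra.adjoin D {r k E}).restrictScalars k).toSubmonoid :=
    Submonoid.closure_le.mpr fun a ha => (Algebra.adjoin D {r k E}).algebraMap_mem ⟨a, hfgD ha⟩
  refine le_antisymm (le_of_saturation_adjoin_eq_top (saturation_f_g_eq_top hr hclosure)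
    (hfgD.trans hle) ?_ fun x hx hxinv => ?_) hle
  · rintro _ (rfl | rfl)
    · exact isSaturated_adjoin_f_g_f
    · exact isSaturated_adjoin_f_g_g ht
  · let δ : Poly k →ₐ[D] (Poly k)[X] := { action k E with commutes' := fun a => hle a.2 }
    obtain ⟨a, rfl⟩ := mem_range_algebraMap_of_map_eq_C (δ := δ)
      (mul_ne_zero (pow_ne_zero E.l (f_ne_zero k E)) (g_ne_zero k E)) action_r hx hxinv
    exact a.2

end ActionInvariants

section FirstGenerator

variable {k : Type*} [Field k] {E : Exponents} {p : ℕ} {h : Poly k}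

/-- The polynomial `w` with `q₁ = x₁ - f ^ l w`. -/
noncomputable def q₁Tail (E : Exponents) (p : ℕ) (h : Poly k) : Poly k :=
  f k E ^ (E.l * (p - 2)) * g k E ^ (p - 2) * h ^ (p - 1) * r k E *
    ∑ i ∈ Finset.range (E.t / p), q k E p h ^ i * (r k E ^ p) ^ (E.t / p - 1 - i)

/-- The rational function `q₁` as a polynomial; see `incl_q₁Poly`. -/
noncomputable def q₁Poly (E : Exponents) (p : ℕ) (h : Poly k) : Poly k :=
  MvPolynomial.X 0 - f k E ^ E.l * q₁Tail E p h

theorem g_mul_q₁Poly (hp : 1 < p) (hpt : p ∣ E.t) :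
    g k E * q₁Poly E p h = f k E ^ (E.l * E.t + 1) + q k E p h ^ (E.t / p) := by
  obtain ⟨n, rfl⟩ := Nat.exists_eq_add_of_le' hp
  rw [q₁Poly, q₁Tail, ← mul_assoc]
  refine mul_sub_mul_geom_sum ?_ ?_
  · rw [mul_comm, X_zero_mul_g, ← pow_mul, Nat.mul_div_cancel' hpt]
  · rw [q, show n + 2 - 1 = n + 1 from rfl, show n + 2 - 2 = n from rfl]
    ring

theorem incl_q₁Poly (hp : 1 < p) (hpt : p ∣ E.t) : incl k (q₁Poly E p h) = q₁ k E p h := by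
  have hg : incl k (g k E) ≠ 0 := by simpa using g_ne_zero k E
  rw [q₁, ← g_mul_q₁Poly hp hpt, map_mul, inv_mul_cancel_left₀ hg]

theorem param_q₁Poly : param k E (q₁Poly E p h) = C X := by
  rw [q₁Poly, map_sub, map_mul, map_pow, param_f, zero_pow (Nat.one_le_iff_ne_zero.mp E.one_le_l),
    zero_mul, sub_zero, param_X_zero]

theorem q₁Poly_ne_zero : q₁Poly E p h ≠ 0 := fun h0 =>
  C_ne_zero.mpr X_ne_zero (param_q₁Poly.symm.trans ((congrArg (param k E) h0).trans (map_zero _)))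

theorem q₁Tail_mem {S : Subalgebra k (Poly k)} (hf : f k E ∈ S) (hg : g k E ∈ S)
    (hr : r k E ∈ S) (hh : h ∈ S) : q₁Tail E p h ∈ S :=
  have hq : q k E p h ∈ S :=
    sub_mem (pow_mem hr _) (mul_mem (pow_mem (mul_mem (mul_mem (pow_mem hf _) hg) hh) _) hr)
  mul_mem (mul_mem (mul_mem (mul_mem (pow_mem hf _) (pow_mem hg _)) (pow_mem hh _)) hr)
    (geom_sum_mem hq (pow_mem hr _) _)

theorem q₁Poly_mem_baseRing : q₁Poly E p h ∈ baseRing k E := ⟨X, param_q₁Poly.symm⟩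

theorem exists_q₁Poly_pow_eq (hh : h ∈ baseRing k E) (n : ℕ) :
    ∃ v ∈ baseRing k E, q₁Poly E p h ^ n = MvPolynomial.X 0 ^ n + f k E ^ E.l * v :=
  exists_pow_eq_add_mul q₁Poly_mem_baseRing (X_zero_mem_baseRing k E)
    (neg_mem (q₁Tail_mem (f_mem_baseRing k E) (g_mem_baseRing k E) (r_mem_baseRing k E) hh))
    (by rw [q₁Poly]; ring) n

end FirstGenerator

section Congruences

variable {k : Type*} [Field k] {E : Exponents} {p : ℕ} [CharP k p] {h : Poly k}

theorem r_pow (hp : p.Prime) :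
    r k E ^ p = f k E ^ (E.l * p) * MvPolynomial.X 1 ^ p + MvPolynomial.X 0 ^ (E.m * p) := by
  have := Fact.mk hp
  rw [r_eq, add_pow_char, mul_pow, ← pow_mul, ← pow_mul]

theorem exists_g_eq (hp : p.Prime) (hpt : p ∣ E.t) :
    ∃ c, g k E = MvPolynomial.X 0 ^ (E.m * E.t - 1) + f k E ^ (E.l * p) * c := by
  have htwo := E.two_le_t
  have hmt := E.three_le_mt
  have hr : f k E ^ (E.l * p) ∣ r k E ^ E.t - (MvPolynomial.X 0 ^ E.m) ^ E.t := by
    obtain ⟨s, hs⟩ := hpt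
    rw [hs, pow_mul _ p, pow_mul _ p]
    exact Dvd.dvd.trans ⟨MvPolynomial.X 1 ^ p, by rw [r_pow hp]; ring⟩
      (sub_dvd_pow_sub_pow _ _ _)
  have hf : f k E ^ (E.l * p) ∣ f k E ^ (E.l * E.t + 1) :=
    pow_dvd_pow _ (Nat.le_succ_of_le (Nat.mul_le_mul_left _ (Nat.le_of_dvd (by omega) hpt)))
  have hdvd : f k E ^ (E.l * p) ∣
      MvPolynomial.X 0 * (g k E - MvPolynomial.X 0 ^ (E.m * E.t - 1)) := by
    rw [mul_sub, X_zero_mul_g, mul_pow_sub_one (by omega), pow_mul _ E.m, add_sub_assoc]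
    exact dvd_add hf hr
  obtain ⟨c, hc⟩ := (prime_f k E).pow_dvd_of_dvd_mul_left _
    (not_f_dvd (by rw [param_X_zero]; exact C_ne_zero.mpr X_ne_zero)) hdvd
  exact ⟨c, by rw [← hc]; ring⟩

theorem exists_eq_add_f_pow_mul_of_mem_adjoin (hp : p.Prime) (hpt : p ∣ E.t)
    (hh : h ∈ baseRing k E) {a : Poly k} (ha : a ∈ Algebra.adjoin k {f k E, g k E}) :
    ∃ b ∈ Algebra.adjoin k {f k E, q₁Poly E p h}, ∃ v ∈ baseRing k E,
      a = b + f k E ^ E.l * v := by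
  have hf := f_mem_baseRing k E
  refine exists_eq_add_mul_of_mem_adjoin (Algebra.adjoin_le ?_) (pow_mem hf _) ?_ ha
  · rintro _ (rfl | rfl)
    exacts [hf, q₁Poly_mem_baseRing]
  rintro _ (rfl | rfl)
  · exact ⟨f k E, Algebra.subset_adjoin (by simp), 0, zero_mem _, by ring⟩
  · obtain ⟨c, hc⟩ := exists_g_eq hp hpt (k := k)
    obtain ⟨v, hv, hq₁⟩ := exists_q₁Poly_pow_eq (p := p) hh (E.m * E.t - 1)
    refine ⟨q₁Poly E p h ^ (E.m * E.t - 1), pow_mem (Algebra.subset_adjoin (by simp)) _, _,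
      sub_mem (f_mul_mem_baseRing k E (f k E ^ (E.l * (p - 1) - 1) * c)) hv, ?_⟩
    have hexp : E.l * p = E.l + (1 + (E.l * (p - 1) - 1)) := by
      obtain ⟨n, rfl⟩ := Nat.exists_eq_add_of_le' hp.two_le
      have := E.one_le_l
      rw [show n + 2 - 1 = n + 1 from rfl, mul_add, mul_add]
      omega
    rw [hq₁]
    nth_rw 1 [hc]
    rw [hexp, pow_add, pow_add, pow_one]
    ring

theorem exists_q_eq (hp : p.Prime) (hh : h ∈ baseRing k E) :
    ∃ w ∈ baseRing k E, q k E p h = q₁Poly E p h ^ (E.m * p) +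
      f k E ^ (E.l * p) * (MvPolynomial.X 1 ^ p - w ^ p) -
        f k E ^ (E.l * (p - 1)) * ((g k E * h) ^ (p - 1) * r k E) := by
  have := Fact.mk hp
  obtain ⟨w, hw, hq₁⟩ := exists_q₁Poly_pow_eq (p := p) hh E.m
  refine ⟨w, hw, ?_⟩
  rw [q, r_pow hp, pow_mul _ E.m p, pow_mul _ E.m p, hq₁, add_pow_char]
  simp only [mul_pow, pow_mul]
  ring

theorem exists_g_mul_pow_mul_r_eq (hp : p.Prime) (hpt : p ∣ E.t)
    (hh : h ∈ Algebra.adjoin k {f k E, g k E}) :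
    ∃ c ∈ Algebra.adjoin k {f k E, q₁Poly E p h}, ∃ a ∈ baseRing k E, ∃ v ∈ baseRing k E,
      (g k E * h) ^ (p - 1) * r k E =
        q₁Poly E p h * c + f k E ^ E.l * (a * MvPolynomial.X 1 + v) := by
  have hhB := adjoin_f_g_le_baseRing k E hh
  have hgh : (g k E * h) ^ (p - 1) ∈ Algebra.adjoin k {f k E, g k E} :=
    pow_mem (mul_mem (Algebra.subset_adjoin (by simp)) hh) _
  have hghB := adjoin_f_g_le_baseRing k E hgh
  obtain ⟨b, hb, v, hv, hbv⟩ := exists_eq_add_f_pow_mul_of_mem_adjoin hp hpt hhB hgh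
  obtain ⟨w, hw, hq₁⟩ := exists_q₁Poly_pow_eq (p := p) hhB E.m
  refine ⟨b * q₁Poly E p h ^ (E.m - 1),
    mul_mem hb (pow_mem (Algebra.subset_adjoin (by simp)) _), _, hghB,
    v * q₁Poly E p h ^ E.m - (g k E * h) ^ (p - 1) * w,
    sub_mem (mul_mem hv (pow_mem q₁Poly_mem_baseRing _)) (mul_mem hghB hw), ?_⟩
  have hm := mul_pow_sub_one (Nat.one_le_iff_ne_zero.mp E.one_le_m) (q₁Poly E p h)
  rw [r_eq]
  linear_combination q₁Poly E p h ^ E.m * hbv - (g k E * h) ^ (p - 1) * hq₁ - b * hm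

end Congruences

section Generators

variable {k : Type*} [Field k] {E : Exponents} {p : ℕ} {h c q₂ q₃ : Poly k}

/-- The conditions on `q₂` under which it is a second generator of the ring of invariants of
`ε_h`: modulo `q₁ k[f, q₁]`, the element `q` is the multiple `f ^ (l p) q₂`, and `q₂` is not a
polynomial in `x₁` on the surface `f = 0`. The quotient by `q₁` is recorded as `c`. -/
structure IsSecondGen (E : Exponents) (p : ℕ) (h c q₂ : Poly k) : Prop where
  mem_adjoin : c ∈ Algebra.adjoin k {f k E, q₁Poly E p h}
  f_pow_mul_eq : f k E ^ (E.l * p) * q₂ = q k E p h - q₁Poly E p h * c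
  natDegree_pos : 0 < (param k E q₂).natDegree

theorem natDegree_param_X_one_pow_sub_pos (hp : 1 < p) {a v : Poly k} (ha : a ∈ baseRing k E)
    (hv : v ∈ baseRing k E) :
    0 < (param k E (MvPolynomial.X 1 ^ p - (a * MvPolynomial.X 1 + v))).natDegree := by
  obtain ⟨a', ha'⟩ := ha
  obtain ⟨v', hv'⟩ := hv
  have hparam : param k E (MvPolynomial.X 1 ^ p - (a * MvPolynomial.X 1 + v)) =
      C (X ^ p) * X ^ p - (C (a' * X) * X + C v') := by
    change C a' = param k E a at ha'
    change C v' = param k E v at hv'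
    simp only [map_sub, map_add, map_mul, map_pow, param_X_one, ← ha', ← hv']
    ring
  refine (Nat.zero_lt_of_lt hp).trans_le (le_natDegree_of_ne_zero ?_)
  rw [hparam, coeff_sub, coeff_add, coeff_C_mul, coeff_C_mul, coeff_X_pow_self,
    coeff_C_of_ne_zero (by omega), coeff_X_of_ne_one (by omega)]
  simp

theorem exists_isSecondGen_of_eq [CharP k p] (hp : p.Prime) (hh : h ∈ baseRing k E) {c a v : Poly k}
    (hc : c ∈ Algebra.adjoin k {f k E, q₁Poly E p h}) (ha : a ∈ baseRing k E)
    (hv : v ∈ baseRing k E) (hr : (g k E * h) ^ (p - 1) * r k E =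
      q₁Poly E p h * c + f k E ^ E.l * (a * MvPolynomial.X 1 + v)) :
    ∃ q₂, IsSecondGen E p h (q₁Poly E p h ^ (E.m * p - 1) - f k E ^ (E.l * (p - 1)) * c) q₂ := by
  obtain ⟨w, hw, hq⟩ := exists_q_eq hp hh
  have hf : f k E ∈ Algebra.adjoin k {f k E, q₁Poly E p h} := Algebra.subset_adjoin (by simp)
  have hq₁ : q₁Poly E p h ∈ Algebra.adjoin k {f k E, q₁Poly E p h} :=
    Algebra.subset_adjoin (by simp)
  refine ⟨MvPolynomial.X 1 ^ p - (a * MvPolynomial.X 1 + (w ^ p + v)),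
    sub_mem (pow_mem hq₁ _) (mul_mem (pow_mem hf _) hc), ?_,
    natDegree_param_X_one_pow_sub_pos hp.one_lt ha (add_mem (pow_mem hw _) hv)⟩
  have hmp := mul_pow_sub_one (Nat.mul_ne_zero (Nat.one_le_iff_ne_zero.mp E.one_le_m) hp.ne_zero)
    (q₁Poly E p h)
  have hlp : f k E ^ (E.l * p) = f k E ^ (E.l * (p - 1)) * f k E ^ E.l := by
    rw [← pow_add, ← Nat.mul_succ, Nat.succ_eq_add_one, Nat.sub_add_cancel hp.one_le]
  linear_combination -hq + f k E ^ (E.l * (p - 1)) * hr + hmp -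
    (a * MvPolynomial.X 1 + v) * hlp

theorem exists_isSecondGen [CharP k p] (hp : p.Prime) (hpt : p ∣ E.t)
    (hh : h ∈ Algebra.adjoin k {f k E, g k E}) : ∃ c q₂, IsSecondGen E p h c q₂ := by
  obtain ⟨c, hc, a, ha, v, hv, hr⟩ := exists_g_mul_pow_mul_r_eq hp hpt hh
  exact ⟨_, exists_isSecondGen_of_eq hp (adjoin_f_g_le_baseRing k E hh) hc ha hv hr⟩

namespace IsSecondGen

theorem q₁Poly_mul_sub (hq₂ : IsSecondGen E p h c q₂) (hp : 1 < p) (hpt : p ∣ E.t) :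
    q₁Poly E p h * (g k E - c * ∑ i ∈ Finset.range (E.t / p),
      (f k E ^ (E.l * p) * q₂) ^ i * q k E p h ^ (E.t / p - 1 - i)) =
        f k E ^ (E.l * E.t) * (f k E + q₂ ^ (E.t / p)) := by
  rw [mul_sub_mul_geom_sum ((mul_comm _ _).trans (g_mul_q₁Poly hp hpt)) hq₂.f_pow_mul_eq, mul_pow,
    ← pow_mul, mul_assoc, Nat.mul_div_cancel' hpt, pow_succ, mul_add]

theorem exists_thirdGen (hq₂ : IsSecondGen E p h c q₂) (hp : 1 < p) (hpt : p ∣ E.t) :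
    ∃ q₃, q₁Poly E p h * q₃ - q₂ ^ (E.t / p) = f k E := by
  have hmul := hq₂.q₁Poly_mul_sub hp hpt
  obtain ⟨q₃, hq₃⟩ := (prime_f k E).pow_dvd_of_dvd_mul_left _
    (not_f_dvd (by rw [param_q₁Poly]; exact C_ne_zero.mpr X_ne_zero)) ⟨_, hmul⟩
  refine ⟨q₃, mul_left_cancel₀ (pow_ne_zero (E.l * E.t) (f_ne_zero k E)) ?_⟩
  rw [hq₃] at hmul
  linear_combination hmul

theorem f_pow_mul_thirdGen_eq (hq₂ : IsSecondGen E p h c q₂) (hp : 1 < p) (hpt : p ∣ E.t)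
    (hq₃ : q₁Poly E p h * q₃ - q₂ ^ (E.t / p) = f k E) :
    f k E ^ (E.l * E.t) * q₃ = g k E - c * ∑ i ∈ Finset.range (E.t / p),
      (f k E ^ (E.l * p) * q₂) ^ i * q k E p h ^ (E.t / p - 1 - i) :=
  mul_left_cancel₀ q₁Poly_ne_zero <| by
    linear_combination f k E ^ (E.l * E.t) * hq₃ - hq₂.q₁Poly_mul_sub hp hpt

theorem q_mem (hq₂ : IsSecondGen E p h c q₂) {S : Subalgebra k (Poly k)} (hf : f k E ∈ S)
    (h1 : q₁Poly E p h ∈ S) (h2 : q₂ ∈ S) : q k E p h ∈ S := by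
  have hc : c ∈ S := Algebra.adjoin_le (by rintro _ (rfl | rfl) <;> assumption) hq₂.mem_adjoin
  rw [sub_eq_iff_eq_add.mp hq₂.f_pow_mul_eq.symm]
  exact add_mem (mul_mem (pow_mem hf _) h2) (mul_mem h1 hc)

theorem g_mem (hq₂ : IsSecondGen E p h c q₂) (hp : 1 < p) (hpt : p ∣ E.t)
    (hq₃ : q₁Poly E p h * q₃ - q₂ ^ (E.t / p) = f k E) {S : Subalgebra k (Poly k)}
    (hf : f k E ∈ S) (h1 : q₁Poly E p h ∈ S) (h2 : q₂ ∈ S) (h3 : q₃ ∈ S) : g k E ∈ S := by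
  have hc : c ∈ S := Algebra.adjoin_le (by rintro _ (rfl | rfl) <;> assumption) hq₂.mem_adjoin
  rw [sub_eq_iff_eq_add.mp (hq₂.f_pow_mul_thirdGen_eq hp hpt hq₃).symm]
  exact add_mem (mul_mem (pow_mem hf _) h3)
    (mul_mem hc (geom_sum_mem (mul_mem (pow_mem hf _) h2) (hq₂.q_mem hf h1 h2) _))

end IsSecondGen

end Generators

section Exponential

variable {k : Type*} [Field k] {E : Exponents} {p : ℕ} {h c q₂ q₃ : Poly k}

theorem f_mem_expInvariants : f k E ∈ expInvariants k E h :=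
  actionInvariants_le_expInvariants (mem_actionInvariants_of_incl_mem (f_mem k E))

theorem g_mem_expInvariants : g k E ∈ expInvariants k E h :=
  actionInvariants_le_expInvariants (mem_actionInvariants_of_incl_mem (g_mem k E))

theorem q_mem_expInvariants [CharP k p] (hp : p.Prime) (hh : h ∈ expInvariants k E h) :
    q k E p h ∈ expInvariants k E h := by
  have := Fact.mk hp
  have hb : expAut k E h (f k E ^ E.l * g k E * h) = f k E ^ E.l * g k E * h :=
    (expInvariants k E h).mul_mem
      (mul_mem (pow_mem f_mem_expInvariants _) g_mem_expInvariants) hh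
  change expAut k E h (q k E p h) = q k E p h
  rw [q, map_sub, map_mul, map_pow, map_pow, hb, expAut_r, add_pow_char]
  linear_combination -pow_sub_one_mul hp.ne_zero (f k E ^ E.l * g k E * h)

theorem q₁Poly_mem_expInvariants [CharP k p] (hp : p.Prime) (hpt : p ∣ E.t)
    (hh : h ∈ expInvariants k E h) : q₁Poly E p h ∈ expInvariants k E h := by
  refine isSaturated_expInvariants g_mem_expInvariants (g_ne_zero k E) ?_
  rw [g_mul_q₁Poly hp.one_lt hpt]
  exact add_mem (pow_mem f_mem_expInvariants _) (pow_mem (q_mem_expInvariants hp hh) _)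

theorem IsSecondGen.mem_expInvariants [CharP k p] (hq₂ : IsSecondGen E p h c q₂) (hp : p.Prime)
    (hpt : p ∣ E.t) (hh : h ∈ expInvariants k E h) : q₂ ∈ expInvariants k E h := by
  have h1 := q₁Poly_mem_expInvariants hp hpt hh
  have hc : c ∈ expInvariants k E h := Algebra.adjoin_le
    (by rintro _ (rfl | rfl); exacts [f_mem_expInvariants, h1]) hq₂.mem_adjoin
  refine (isSaturated_expInvariants f_mem_expInvariants (f_ne_zero k E)).mem_of_pow_mul_mem
    (E.l * p) ?_
  rw [hq₂.f_pow_mul_eq]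
  exact sub_mem (q_mem_expInvariants hp hh) (mul_mem h1 hc)

theorem saturation_f_eq_top {S : Subalgebra k (Poly k)} (hg : g k E ∈ S) (hr : r k E ∈ S)
    (hh : h ∈ S) (h1 : q₁Poly E p h ∈ S) (hM : Submonoid.closure {f k E} ≤ S.toSubmonoid) :
    S.saturation _ hM = ⊤ := by
  have hfM : f k E ∈ Submonoid.closure {f k E} := Submonoid.mem_closure_singleton_self
  have hf : f k E ∈ S := hM hfM
  have hle : S ≤ S.saturation _ hM := Subalgebra.le_saturation
  refine eq_top_of_isSaturated (isSaturated_saturation hfM) (hle hf) (hle hg) (hle hr) (hle ?_)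
  rw [← sub_add_cancel (MvPolynomial.X 0) (f k E ^ E.l * q₁Tail E p h)]
  exact add_mem h1 (mul_mem (pow_mem hf _) (q₁Tail_mem hf hg hr hh))

theorem saturation_adjoin_r_eq_top {D : Subalgebra k (Poly k)} (hg : g k E ∈ D) (hh : h ∈ D)
    (h1 : q₁Poly E p h ∈ D) (hM : Submonoid.closure {f k E} ≤
      ((Algebra.adjoin D {r k E}).restrictScalars k).toSubmonoid) :
    ((Algebra.adjoin D {r k E}).restrictScalars k).saturation _ hM = ⊤ :=
  have hD (a : Poly k) (ha : a ∈ D) : a ∈ (Algebra.adjoin D {r k E}).restrictScalars k :=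
    (Algebra.adjoin D {r k E}).algebraMap_mem ⟨a, ha⟩
  saturation_f_eq_top (hD _ hg) (Algebra.self_mem_adjoin_singleton D (r k E)) (hD _ hh) (hD _ h1) hM

theorem closure_f_le_adjoin_r {D : Subalgebra k (Poly k)} (hf : f k E ∈ D) :
    Submonoid.closure {f k E} ≤
      ((Algebra.adjoin D {r k E}).restrictScalars k).toSubmonoid :=
  Submonoid.closure_le.mpr (Set.singleton_subset_iff.mpr
    ((Algebra.adjoin D {r k E}).algebraMap_mem ⟨f k E, hf⟩))

theorem expInvariants_eq_of_isSaturated [CharP k p] (hp : 1 < p) (h0 : h ≠ 0)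
    {D : Subalgebra k (Poly k)} (hDB : D ≤ expInvariants k E h) (hf : f k E ∈ D) (hg : g k E ∈ D)
    (hh : h ∈ D) (hq : q k E p h ∈ D) (h1 : q₁Poly E p h ∈ D) (hsat : IsSaturated D (f k E)) :
    expInvariants k E h = D := by
  refine le_antisymm (le_of_saturation_adjoin_eq_top
    (saturation_adjoin_r_eq_top hg hh h1 (closure_f_le_adjoin_r hf))
    (Set.singleton_subset_iff.mpr (hDB hf)) (by simpa using hsat) fun x hx hxinv => ?_) hDB
  let σ : Poly k →ₐ[D] Poly k := { expAut k E h with commutes' := fun a => hDB a.2 }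
  let b : D := ⟨f k E ^ E.l * g k E * h, mul_mem (mul_mem (pow_mem hf _) hg) hh⟩
  have hb : algebraMap D (Poly k) b ≠ 0 :=
    mul_ne_zero (mul_ne_zero (pow_ne_zero _ (f_ne_zero k E)) (g_ne_zero k E)) h0
  obtain ⟨a, rfl⟩ := mem_range_algebraMap_of_map_eq (c := (⟨q k E p h, hq⟩ : D)) hp (σ := σ) hb
    expAut_r rfl hx hxinv
  exact a.2

theorem isAlgebraic_of_mem (hp : 1 < p) {D : Subalgebra k (Poly k)} (hf : f k E ∈ D)
    (hg : g k E ∈ D) (hh : h ∈ D) (hq : q k E p h ∈ D) (h1 : q₁Poly E p h ∈ D) :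
    Algebra.IsAlgebraic D (Poly k) := by
  let b : D := ⟨(f k E ^ E.l * g k E * h) ^ (p - 1),
    pow_mem (mul_mem (mul_mem (pow_mem hf _) hg) hh) _⟩
  obtain ⟨Q, hQ, -, hroot⟩ := exists_monic_natDegree_eq (b := b) (c := (⟨q k E p h, hq⟩ : D))
    (r := r k E) hp rfl
  exact isAlgebraic_of_saturation_adjoin_eq_top
    (saturation_adjoin_r_eq_top hg hh h1 (closure_f_le_adjoin_r hf))
    (Set.singleton_subset_iff.mpr hf) (f_ne_zero k E).symm (IsIntegral.isAlgebraic ⟨Q, hQ, hroot⟩)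

theorem IsSecondGen.expInvariants_eq [CharP k p] (hq₂ : IsSecondGen E p h c q₂) (hp : p.Prime)
    (hpt : p ∣ E.t) (h0 : h ≠ 0) (hh : h ∈ Algebra.adjoin k {f k E, g k E})
    (hq₃ : q₁Poly E p h * q₃ - q₂ ^ (E.t / p) = f k E) :
    expInvariants k E h = Algebra.adjoin k (Set.range ![q₁Poly E p h, q₂, q₃]) ∧
      AlgebraicIndependent k ![q₁Poly E p h, q₂, q₃] := by
  set x := ![q₁Poly E p h, q₂, q₃]
  have hx (i : Fin 3) : x i ∈ Algebra.adjoin k (Set.range x) := Algebra.subset_adjoin ⟨i, rfl⟩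
  have hf : f k E ∈ Algebra.adjoin k (Set.range x) :=
    hq₃ ▸ sub_mem (mul_mem (hx 0) (hx 2)) (pow_mem (hx 1) _)
  have hg := hq₂.g_mem hp.one_lt hpt hq₃ hf (hx 0) (hx 1) (hx 2)
  have hq := hq₂.q_mem hf (hx 0) (hx 1)
  have hhD : h ∈ Algebra.adjoin k (Set.range x) :=
    Algebra.adjoin_le (by rintro _ (rfl | rfl) <;> assumption) hh
  have hhB : h ∈ expInvariants k E h :=
    actionInvariants_le_expInvariants (adjoin_f_g_le_actionInvariants hh)
  have h1 := q₁Poly_mem_expInvariants hp hpt hhB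
  have h2 := hq₂.mem_expInvariants hp hpt hhB
  have h3 : q₃ ∈ expInvariants k E h := by
    refine isSaturated_expInvariants h1 q₁Poly_ne_zero ?_
    rw [sub_eq_iff_eq_add.mp hq₃]
    exact add_mem f_mem_expInvariants (pow_mem h2 _)
  have hle : Algebra.adjoin k (Set.range x) ≤ expInvariants k E h :=
    Algebra.adjoin_le (by rw [range_fin_three]; rintro _ (rfl | rfl | rfl) <;> assumption)
  have hsat : IsSaturated (Algebra.adjoin k (Set.range x)) (f k E) :=
    isSaturated_adjoin_range (param k E) hq₃ (f_ne_zero k E) (param_f k E)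
      (by rw [show param k E (x 0) = C X from param_q₁Poly]
          exact algebraicIndependent_C_X_of_natDegree_pos hq₂.natDegree_pos)
  exact ⟨expInvariants_eq_of_isSaturated hp.one_lt h0 hle hf hg hhD hq (hx 0) hsat,
    algebraicIndependent_of_isAlgebraic_adjoin
      (isAlgebraic_of_mem hp.one_lt hf hg hhD hq (hx 0))⟩

end Exponential

section Psi

variable {k : Type*} [Field k] {E : Exponents} {p : ℕ} {h q₂ q₃ : Poly k}

/-- The polynomials over `C` with values `x₁`, `x₂ ^ p`, `x₃` at `r ^ p`; their values at `q` are
the images of `x₁`, `x₂ ^ p`, `x₃` under `ψ`. -/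
noncomputable def coordPoly (k : Type*) [Field k] (E : Exponents) (p : ℕ) :
    Fin 3 → (ringC k E)[X] :=
  let u : (ringC k E)[X] := C ⟨_, g_inv_mem k E⟩ *
    (C ⟨_, f_mem k E⟩ ^ (E.l * E.t + 1) + X ^ (E.t / p))
  ![u,
    C ⟨_, f_inv_mem k E⟩ ^ (E.l * p) * (X - u ^ (E.m * p)),
    C ⟨_, f_inv_mem k E⟩ ^ (E.l * E.t) * (C ⟨_, g_mem k E⟩ - u ^ (E.m * p - 1) *
      ∑ i ∈ Finset.range (E.t / p), (X - u ^ (E.m * p)) ^ i * X ^ (E.t / p - 1 - i))]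

theorem incl_injective : Function.Injective (incl k) :=
  IsFractionRing.injective (Poly k) (RatFun k)

theorem incl_f_pow_ne_zero (n : ℕ) : incl k (f k E) ^ n ≠ 0 :=
  pow_ne_zero n ((map_ne_zero_iff _ incl_injective).mpr (f_ne_zero k E))

theorem aeval_coordPoly_zero (hp : 1 < p) (hpt : p ∣ E.t) :
    aeval (incl k (q k E p h)) (coordPoly k E p 0) = incl k (q₁Poly E p h) := by
  rw [incl_q₁Poly hp hpt, q₁, map_add, map_pow, map_pow]
  simp only [coordPoly, Matrix.cons_val_zero, map_mul, map_add, map_pow, aeval_C, aeval_X]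
  rfl

theorem f_pow_mul_aeval_coordPoly_one (hp : 1 < p) (hpt : p ∣ E.t) :
    incl k (f k E) ^ (E.l * p) * aeval (incl k (q k E p h)) (coordPoly k E p 1) =
      incl k (q k E p h - q₁Poly E p h ^ (E.m * p)) := by
  have hu := aeval_coordPoly_zero (h := h) (k := k) hp hpt
  have hf : algebraMap (ringC k E) (RatFun k) ⟨_, f_inv_mem k E⟩ = (incl k (f k E))⁻¹ := rfl
  have h1 : coordPoly k E p 1 =
    C ⟨_, f_inv_mem k E⟩ ^ (E.l * p) * (X - coordPoly k E p 0 ^ (E.m * p)) := rfl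
  rw [h1, map_mul, map_pow, aeval_sub, map_pow, hu, aeval_C, aeval_X, hf, inv_pow,
    mul_inv_cancel_left₀ (incl_f_pow_ne_zero _), map_sub, map_pow]

theorem f_pow_mul_aeval_coordPoly_two (hp : 1 < p) (hpt : p ∣ E.t) :
    incl k (f k E) ^ (E.l * E.t) * aeval (incl k (q k E p h)) (coordPoly k E p 2) =
      incl k (g k E - q₁Poly E p h ^ (E.m * p - 1) * ∑ i ∈ Finset.range (E.t / p),
        (q k E p h - q₁Poly E p h ^ (E.m * p)) ^ i * q k E p h ^ (E.t / p - 1 - i)) := by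
  have hu := aeval_coordPoly_zero (h := h) (k := k) hp hpt
  have hf : algebraMap (ringC k E) (RatFun k) ⟨_, f_inv_mem k E⟩ = (incl k (f k E))⁻¹ := rfl
  have hg : algebraMap (ringC k E) (RatFun k) ⟨_, g_mem k E⟩ = incl k (g k E) := rfl
  have h2 : coordPoly k E p 2 = C ⟨_, f_inv_mem k E⟩ ^ (E.l * E.t) *
    (C ⟨_, g_mem k E⟩ - coordPoly k E p 0 ^ (E.m * p - 1) * ∑ i ∈ Finset.range (E.t / p),
      (X - coordPoly k E p 0 ^ (E.m * p)) ^ i * X ^ (E.t / p - 1 - i)) := rfl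
  rw [h2]
  simp only [map_mul, aeval_sub, map_sub, map_pow, map_sum, hu, aeval_C, aeval_X, hf, hg]
  rw [inv_pow, mul_inv_cancel_left₀ (incl_f_pow_ne_zero _)]

theorem IsSecondGen.aeval_coordPoly
    (hq₂ : IsSecondGen E p h (q₁Poly E p h ^ (E.m * p - 1)) q₂) (hp : 1 < p) (hpt : p ∣ E.t)
    (hq₃ : q₁Poly E p h * q₃ - q₂ ^ (E.t / p) = f k E) (i : Fin 3) :
    aeval (incl k (q k E p h)) (coordPoly k E p i) = incl k (![q₁Poly E p h, q₂, q₃] i) := by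
  have hmp := mul_pow_sub_one (Nat.mul_ne_zero (Nat.one_le_iff_ne_zero.mp E.one_le_m)
    (Nat.ne_zero_of_lt hp)) (q₁Poly E p h)
  have h2 : q k E p h - q₁Poly E p h ^ (E.m * p) = f k E ^ (E.l * p) * q₂ := by
    rw [hq₂.f_pow_mul_eq, hmp]
  fin_cases i
  · exact aeval_coordPoly_zero hp hpt
  · refine mul_left_cancel₀ (incl_f_pow_ne_zero (E := E) (E.l * p)) ?_
    refine (f_pow_mul_aeval_coordPoly_one hp hpt).trans ?_
    rw [h2, map_mul, map_pow]
    rfl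
  · refine mul_left_cancel₀ (incl_f_pow_ne_zero (E := E) (E.l * E.t)) ?_
    refine (f_pow_mul_aeval_coordPoly_two hp hpt).trans ?_
    rw [h2, ← hq₂.f_pow_mul_thirdGen_eq hp hpt hq₃, map_mul, map_pow]
    rfl

theorem q_zero (hp : 1 < p) : q k E p 0 = r k E ^ p := by
  rw [q, mul_zero, zero_pow (Nat.sub_ne_zero_of_lt hp), zero_mul, sub_zero]

theorem q₁Poly_zero (hp : 1 < p) : q₁Poly E p (0 : Poly k) = MvPolynomial.X 0 := by
  rw [q₁Poly, q₁Tail, zero_pow (Nat.sub_ne_zero_of_lt hp)]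
  ring

theorem isSecondGen_X_one_pow [CharP k p] (hp : p.Prime) :
    IsSecondGen E p (0 : Poly k) (q₁Poly E p 0 ^ (E.m * p - 1)) (MvPolynomial.X 1 ^ p) where
  mem_adjoin := pow_mem (Algebra.subset_adjoin (by simp)) _
  f_pow_mul_eq := by
    rw [mul_pow_sub_one (Nat.mul_ne_zero (Nat.one_le_iff_ne_zero.mp E.one_le_m) hp.ne_zero),
      q_zero hp.one_lt, q₁Poly_zero hp.one_lt, r_pow hp, add_sub_cancel_right]
  natDegree_pos := by
    simpa using natDegree_param_X_one_pow_sub_pos (k := k) (E := E) hp.one_lt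
      (zero_mem _) (zero_mem _)

theorem aeval_r_pow_coordPoly [CharP k p] (hp : p.Prime) (hpt : p ∣ E.t) (i : Fin 3) :
    aeval (incl k (r k E) ^ p) (coordPoly k E p i) =
      incl k (![MvPolynomial.X 0, MvPolynomial.X 1 ^ p, MvPolynomial.X 2] i) := by
  have hX : q₁Poly E p 0 * MvPolynomial.X 2 - (MvPolynomial.X 1 ^ p) ^ (E.t / p) = f k E := by
    rw [q₁Poly_zero hp.one_lt, ← pow_mul, Nat.mul_div_cancel' hpt, f_eq]
  have hcoord := (isSecondGen_X_one_pow hp).aeval_coordPoly hp.one_lt hpt hX i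
  rwa [q_zero hp.one_lt, q₁Poly_zero hp.one_lt, map_pow] at hcoord

theorem adjoin_X_eq_map_aeval [CharP k p] (hp : p.Prime) (hpt : p ∣ E.t) :
    Algebra.adjoin k {incl k (MvPolynomial.X 0), incl k (MvPolynomial.X 1 ^ p),
      incl k (MvPolynomial.X 2)} = (Algebra.adjoin k (Set.range (coordPoly k E p))).map
        ((aeval (R := ringC k E) (incl k (r k E) ^ p)).restrictScalars k) := by
  rw [AlgHom.map_adjoin, ← Set.range_comp, range_fin_three]
  congr 1
  simp only [Function.comp_apply, AlgHom.restrictScalars_apply, aeval_r_pow_coordPoly hp hpt]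
  rfl

theorem adjoin_X_subset_ringCrp [CharP k p] (hp : p.Prime) (hpt : p ∣ E.t) :
    (Algebra.adjoin k {incl k (MvPolynomial.X 0), incl k (MvPolynomial.X 1 ^ p),
      incl k (MvPolynomial.X 2)} : Set (RatFun k)) ⊆ ringCrp k E p := by
  rw [adjoin_X_eq_map_aeval hp hpt]
  rintro _ ⟨V, -, rfl⟩
  exact ⟨V, rfl⟩

theorem psi_of_eq_aeval (hp : 0 < p) {u : ringCrp k E p} {V : (ringC k E)[X]}
    (hV : aeval (incl k (r k E) ^ p) V = (u : RatFun k)) :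
    psi k E p hp h u = aeval (incl k (q k E p h)) V := by
  have hsymm : (polyEquivCrp k E p hp).symm u = V :=
    (AlgEquiv.symm_apply_eq _).mpr (Subtype.ext hV.symm)
  exact congrArg (aeval (incl k (q k E p h))) hsymm

theorem psi_image_eq [CharP k p] (hp : p.Prime) (hpt : p ∣ E.t) :
    psi k E p hp.pos h '' {u | (u : RatFun k) ∈ Algebra.adjoin k {incl k (MvPolynomial.X 0),
      incl k (MvPolynomial.X 1 ^ p), incl k (MvPolynomial.X 2)}} =
    Algebra.adjoin k (Set.range fun i => aeval (incl k (q k E p h)) (coordPoly k E p i)) := by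
  have hmap := AlgHom.map_adjoin ((aeval (R := ringC k E) (incl k (q k E p h))).restrictScalars k)
    (Set.range (coordPoly k E p))
  rw [← Set.range_comp] at hmap
  refine Eq.trans ?_ (congrArg SetLike.coe hmap)
  rw [adjoin_X_eq_map_aeval hp hpt]
  ext y
  constructor
  · rintro ⟨u, ⟨V, hV, hVu⟩, rfl⟩
    exact ⟨V, hV, (psi_of_eq_aeval hp.pos hVu).symm⟩
  · rintro ⟨V, hV, rfl⟩
    exact ⟨⟨_, V, rfl⟩, ⟨V, hV, rfl⟩, psi_of_eq_aeval hp.pos rfl⟩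

theorem psi_image_eq_of_pow_eq [CharP k p] (hp : p.Prime) (hpt : p ∣ E.t) (h0 : h ≠ 0)
    (hh : h ∈ Algebra.adjoin k {f k E, g k E}) {u : Poly k}
    (hu : u ∈ Algebra.adjoin k {f k E, g k E}) (hhu : h ^ (p - 1) = f k E ^ E.l * u) :
    psi k E p hp.pos h '' {u | (u : RatFun k) ∈ Algebra.adjoin k {incl k (MvPolynomial.X 0),
      incl k (MvPolynomial.X 1 ^ p), incl k (MvPolynomial.X 2)}} =
    incl k '' (expInvariants k E h : Set (Poly k)) := by
  have hB := adjoin_f_g_le_baseRing k E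
  obtain ⟨q₂, hq₂⟩ := exists_isSecondGen_of_eq (c := 0) (a := 0) (v := g k E ^ (p - 1) * u * r k E)
    hp (hB hh) (zero_mem _) (zero_mem _)
    (mul_mem (mul_mem (pow_mem (g_mem_baseRing k E) _) (hB hu)) (r_mem_baseRing k E))
    (by rw [mul_pow, hhu]; ring)
  rw [mul_zero, sub_zero] at hq₂
  obtain ⟨q₃, hq₃⟩ := hq₂.exists_thirdGen hp.one_lt hpt
  rw [psi_image_eq hp hpt, (hq₂.expInvariants_eq hp hpt h0 hh hq₃).1, ← Subalgebra.coe_map,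
    AlgHom.map_adjoin, ← Set.range_comp]
  simp only [hq₂.aeval_coordPoly hp.one_lt hpt hq₃]
  rfl

theorem f_pow_dvd_pow_of_f_pow_mul_eq [CharP k p] (hp : p.Prime) (hh : h ∈ baseRing k E)
    {b : Poly k} (hb : f k E ^ (E.l * p) * b = q k E p h - q₁Poly E p h ^ (E.m * p)) :
    f k E ^ E.l ∣ h ^ (p - 1) := by
  obtain ⟨w, -, hq⟩ := exists_q_eq hp hh
  have hlp : f k E ^ (E.l * p) = f k E ^ (E.l * (p - 1)) * f k E ^ E.l := by
    rw [← pow_add, ← Nat.mul_succ, Nat.succ_eq_add_one, Nat.sub_add_cancel hp.one_le]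
  have heq : g k E ^ (p - 1) * r k E * h ^ (p - 1) =
      f k E ^ E.l * (MvPolynomial.X 1 ^ p - w ^ p - b) := by
    refine mul_left_cancel₀ (pow_ne_zero (E.l * (p - 1)) (f_ne_zero k E)) ?_
    rw [mul_pow] at hq
    linear_combination hb + hq + (MvPolynomial.X 1 ^ p - w ^ p - b) * hlp
  have hnd : ¬ f k E ∣ g k E ^ (p - 1) * r k E := by
    refine not_f_dvd ?_
    rw [map_mul, map_pow, param_g, param_r]
    simp
  exact (prime_f k E).pow_dvd_of_dvd_mul_left _ hnd ⟨_, heq⟩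

theorem exists_pow_eq_of_psi_image_eq [CharP k p] (hp : p.Prime) (hpt : p ∣ E.t)
    (hh : h ∈ Algebra.adjoin k {f k E, g k E})
    (himage : psi k E p hp.pos h '' {u | (u : RatFun k) ∈ Algebra.adjoin k
      {incl k (MvPolynomial.X 0), incl k (MvPolynomial.X 1 ^ p), incl k (MvPolynomial.X 2)}} =
        incl k '' (expInvariants k E h : Set (Poly k))) :
    ∃ u ∈ Algebra.adjoin k {f k E, g k E}, h ^ (p - 1) = f k E ^ E.l * u := by
  obtain ⟨b, -, hb⟩ : aeval (incl k (q k E p h)) (coordPoly k E p 1) ∈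
      incl k '' (expInvariants k E h : Set (Poly k)) := by
    rw [← himage, psi_image_eq hp hpt]
    exact Algebra.subset_adjoin ⟨1, rfl⟩
  have hfb := f_pow_mul_aeval_coordPoly_one (h := h) (k := k) hp.one_lt hpt
  rw [← hb, ← map_pow, ← map_mul] at hfb
  obtain ⟨u, hu⟩ := f_pow_dvd_pow_of_f_pow_mul_eq hp (adjoin_f_g_le_baseRing k E hh)
    (incl_injective hfb)
  exact ⟨u, isSaturated_adjoin_f_g_f.mem_of_pow_mul_mem _ (hu ▸ pow_mem hh _), hu⟩

end Psi

end RankThree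

theorem mainTheorem6 {k : Type*} [Field k] (p : ℕ) (hp : p.Prime) [CharP k p]
    (E : Exponents) (hpt : p ∣ E.t)
    (h : RankThree.Poly k) (hinv : h ∈ RankThree.actionInvariants k E) (h0 : h ≠ 0) :
    ((∃ q₁ q₂ q₃ : RankThree.Poly k,
        q₁ ∈ RankThree.expInvariants k E h ∧
        q₂ ∈ RankThree.expInvariants k E h ∧
        q₃ ∈ RankThree.expInvariants k E h ∧
        RankThree.incl k q₁ = RankThree.q₁ k E p h ∧
        q₁ * q₃ - q₂ ^ (E.t / p) = RankThree.f k E ∧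
        RankThree.expInvariants k E h = Algebra.adjoin k {q₁, q₂, q₃} ∧
        AlgebraicIndependent k ![q₁, q₂, q₃]) ∧
      Nonempty (RankThree.expInvariants k E h ≃ₐ[k] MvPolynomial (Fin 3) k)) ∧
    ((Algebra.adjoin k {RankThree.incl k (MvPolynomial.X 0),
          RankThree.incl k (MvPolynomial.X 1 ^ p), RankThree.incl k (MvPolynomial.X 2)} :
          Set (RankThree.RatFun k)) ⊆ RankThree.ringCrp k E p ∧
      (RankThree.psi k E p hp.pos h ''
          {u | (u : RankThree.RatFun k) ∈ Algebra.adjoin k {RankThree.incl k (MvPolynomial.X 0),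
            RankThree.incl k (MvPolynomial.X 1 ^ p), RankThree.incl k (MvPolynomial.X 2)}} =
          RankThree.incl k '' (RankThree.expInvariants k E h : Set (RankThree.Poly k)) ↔
        ∃ u ∈ Algebra.adjoin k {RankThree.f k E, RankThree.g k E},
          h ^ (p - 1) = RankThree.f k E ^ E.l * u)) := by
  have ht : (E.t : k) = 0 := (CharP.cast_eq_zero_iff k p E.t).mpr hpt
  have hh : h ∈ Algebra.adjoin k {RankThree.f k E, RankThree.g k E} :=
    RankThree.actionInvariants_eq ht ▸ hinv
  refine ⟨?_, RankThree.adjoin_X_subset_ringCrp hp hpt,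
    RankThree.exists_pow_eq_of_psi_image_eq hp hpt hh,
    fun ⟨_, hu, hhu⟩ => RankThree.psi_image_eq_of_pow_eq hp hpt h0 hh hu hhu⟩
  obtain ⟨c, q₂, hq₂⟩ := RankThree.exists_isSecondGen hp hpt hh
  obtain ⟨q₃, hq₃⟩ := hq₂.exists_thirdGen hp.one_lt hpt
  obtain ⟨hgen, hindep⟩ := hq₂.expInvariants_eq hp hpt h0 hh hq₃
  have hmem (i : Fin 3) : ![RankThree.q₁Poly E p h, q₂, q₃] i ∈ RankThree.expInvariants k E h :=
    hgen ▸ Algebra.subset_adjoin ⟨i, rfl⟩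
  refine ⟨⟨RankThree.q₁Poly E p h, q₂, q₃, hmem 0, hmem 1, hmem 2,
    RankThree.incl_q₁Poly hp.one_lt hpt, hq₃, ?_, hindep⟩, ?_⟩
  · rw [hgen, RankThree.range_fin_three]
    rfl
  · rw [hgen]
    exact ⟨hindep.aevalEquiv.symm⟩
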